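/- Let $B_n$ be the Artin braid group on $n$ strands, $B'_n=[B_n,B_n]$ its commutator subgroup, $A_n$ the alternating group on $n$ letters, and $\pi\colon B'_n\to A_n$ the natural map, i.e. the restriction to $B'_n$ of the projection $B_n\to S_n$ that sends the generator $\sigma_i$ to the transposition $(i\ i+1)$. Suppose $n\ge 5$ and let $q\colon B'_n\to G$ be a surjective homomorphism onto a nontrivial group $G$. Then either $|G|>|A_n|=\frac{n!}{2}$ (where $G$ may be infinite), or $G$ is isomorphic to $A_n$. Moreover, in the latter case, $q$ is obtained from $\pi$ by postcomposing with an automorphism of $A_n$: for every isomorphism $e\colon G\to A_n$ there is an automorphism $\alpha$ of $A_n$ with $e\circ q=\alpha\circ\pi$. -/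

import Mathlib

open scoped Nat

/-- The relators of Artin's presentation of the braid group on `n` strands. The generator with
index `i : Fin (n - 1)` (counted from `0`) crosses the strands in the positions `i` and `i + 1`. -/
inductive BraidGroup.Relator (n : ℕ) : FreeGroup (Fin (n - 1)) → Prop
  | braid (i j : Fin (n - 1)) (h : (i : ℕ) + 1 = j) :
      Relator n ((FreeGroup.of i * FreeGroup.of j * FreeGroup.of i) *
        (FreeGroup.of j * FreeGroup.of i * FreeGroup.of j)⁻¹)
  | comm (i j : Fin (n - 1)) (h : (i : ℕ) + 2 ≤ j) :
      Relator n ((FreeGroup.of i * FreeGroup.of j) * (FreeGroup.of j * FreeGroup.of i)⁻¹)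

/-- The Artin braid group on `n` strands. -/
abbrev BraidGroup (n : ℕ) : Type :=
  PresentedGroup {r | BraidGroup.Relator n r}

/-- The adjacent transposition `(i, i + 1)` of the positions `0, …, n - 1`. -/
def BraidGroup.adjSwap (n : ℕ) (i : Fin (n - 1)) : Equiv.Perm (Fin n) :=
  Equiv.swap ⟨i, by omega⟩ ⟨i + 1, by omega⟩

theorem BraidGroup.lift_relator (n : ℕ) :
    ∀ r ∈ {r | BraidGroup.Relator n r}, FreeGroup.lift (BraidGroup.adjSwap n) r = 1 := by
  rintro r (⟨i, j, h⟩ | ⟨i, j, h⟩)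
  · simp only [map_mul, map_inv, FreeGroup.lift_apply_of, mul_inv_eq_one]
    obtain ⟨a, ha⟩ : ∃ a : Fin n, (a : ℕ) = i := ⟨⟨i, by omega⟩, rfl⟩
    obtain ⟨b, hb⟩ : ∃ b : Fin n, (b : ℕ) = i + 1 := ⟨⟨i + 1, by omega⟩, rfl⟩
    obtain ⟨c, hc⟩ : ∃ c : Fin n, (c : ℕ) = i + 2 := ⟨⟨i + 2, by omega⟩, rfl⟩
    have hi : adjSwap n i = Equiv.swap a b :=
      congrArg₂ Equiv.swap (Fin.ext ha.symm) (Fin.ext hb.symm)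
    have hj : adjSwap n j = Equiv.swap b c :=
      congrArg₂ Equiv.swap (Fin.ext (by simp; omega)) (Fin.ext (by simp; omega))
    rw [hi, hj, Equiv.swap_mul_swap_mul_swap (x := a) (by omega) (by omega),
      Equiv.swap_comm a b, Equiv.swap_comm b c,
      Equiv.swap_mul_swap_mul_swap (x := c) (by omega) (by omega), Equiv.swap_comm]
  · simp only [map_mul, map_inv, FreeGroup.lift_apply_of, mul_inv_eq_one]
    refine (Equiv.Perm.disjoint_iff_disjoint_support.2 ?_).commute.eq
    simp only [adjSwap]
    rw [Equiv.Perm.support_swap (by simp [Fin.ext_iff]),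
      Equiv.Perm.support_swap (by simp [Fin.ext_iff])]
    simp [Fin.ext_iff]
    omega

/-- The forgetful projection from the braid group to the symmetric group. -/
def BraidGroup.toPerm (n : ℕ) : BraidGroup n →* Equiv.Perm (Fin n) :=
  PresentedGroup.toGroup (BraidGroup.lift_relator n)

theorem BraidGroup.toPerm_mem (n : ℕ) (x : commutator (BraidGroup n)) :
    BraidGroup.toPerm n x ∈ alternatingGroup (Fin n) :=
  Abelianization.commutator_subset_ker
    ((Equiv.Perm.sign (α := Fin n)).comp (BraidGroup.toPerm n)) x.2

/-- The natural map from the commutator subgroup of the braid group to the alternating group,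
the restriction of the forgetful projection. -/
def BraidGroup.toAlternating (n : ℕ) :
    commutator (BraidGroup n) →* alternatingGroup (Fin n) :=
  ((BraidGroup.toPerm n).comp (commutator (BraidGroup n)).subtype).codRestrict
    (alternatingGroup (Fin n)) (BraidGroup.toPerm_mem n)

open scoped commutatorElement

universe u

/-! ### Consequences of the braid relation -/

section BraidRelation

variable {G : Type*} [Group G] {a b c : G}

/-! Let K be the largest normal subgroup of B_n contained in ker q (`core q`). The proof splits on
whether the squares of all generators σ_i agree modulo K (`SquaresAgree q`).

If they agree, the common square is central modulo K. Pure braids form the normal closure of σ_0²,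
so modulo K each is a power of that central element, and the exponent sum leaves only the trivial
power for a pure braid in B'_n. Hence q factors through A_n (`toAlternating_ker_le`), and simplicity
of A_n makes G isomorphic to A_n.

If they do not agree, a finite G has more than n!/2 elements (`lt_card_of_not_squaresAgree`, by
induction on n). Two estimates are multiplied. Every proper subgroup of G has index at least n
(`le_index_of_ne_top`): B'_n is perfect, so G acts on cosets by even permutations, and the image is
too large for fewer than n points. For n ≥ 6 some proper subgroup has more than (n-1)!/2 elements
(`exists_proper_subgroup`): the normalizer of [P, P], where P is generated by the q(σ_i σ_{n-2}⁻¹)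
with i < n-4. The order of P is bounded below by counting cosets, one generator at a time.

For n = 5 the elements a = q(σ_0 σ_3⁻¹) and b = q(σ_1 σ_3⁻¹) are studied directly. If they generate
a proper subgroup, its order is at least 21 and its index at least 5. Otherwise, once the center is
divided out, a has order 8 and |G| ≥ 64.

Relations in G return to B_n/K by one principle (`mem_core_of_commute`): a braid killed by q that
commutes with some σ_j lies in K. -/

theorem braid_inv_mul_mul (h : a * b * a = b * a * b) : b⁻¹ * a * b = a * b * a⁻¹ :=
  calc b⁻¹ * a * b = b⁻¹ * (a * b * a) * a⁻¹ := by group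
    _ = a * b * a⁻¹ := by rw [h]; group

theorem braid_conj (h : a * b * a = b * a * b) : a * b * a * (a * b)⁻¹ = b :=
  calc a * b * a * (a * b)⁻¹ = (a * b * a) * (a * b)⁻¹ := by group
    _ = b := by rw [h]; group

theorem braid_conj_pow (h : a * b * a = b * a * b) (m : ℕ) :
    a * b * a ^ m * (a * b)⁻¹ = b ^ m := by
  rw [← conj_pow, braid_conj h]

/-- Conjugation by `a * b` carries `a` to `b`, yet fixes `a ^ m`, which commutes with both factors.
-/
theorem braid_pow_eq_of_commute (h : a * b * a = b * a * b) {m : ℕ} (hc : Commute (a ^ m) b) :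
    a ^ m = b ^ m := by
  rw [← braid_conj_pow h m, eq_mul_inv_iff_mul_eq]
  exact ((Commute.pow_self a m).mul_right hc).eq

theorem braid_commute_pow_symm (h : a * b * a = b * a * b) {m : ℕ} (hc : Commute (b ^ m) a) :
    Commute (a ^ m) b := by
  have := braid_pow_eq_of_commute h.symm hc
  rw [← this]
  exact Commute.pow_self b m

/-- If the commutator subgroup of the first three strands of a braid group on four strands becomes
abelian, the squares of the two commuting generators agree. -/
theorem braid_sq_eq_of_commute (hab : a * b * a = b * a * b) (hbc : b * c * b = c * b * c)
    (hac : Commute a c) (huv : Commute (b * a⁻¹) (a * (b * a⁻¹) * a⁻¹)) : a ^ 2 = c ^ 2 := by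
  -- In the braid group on four strands, `x` and `y` generate the free kernel of the map to three
  -- strands that sends `c` to `a`. The calculation records how `u` and `v` act on this kernel by
  -- conjugation.
  obtain ⟨x, hx⟩ : ∃ x, x = c * a⁻¹ := ⟨_, rfl⟩
  obtain ⟨y, hy⟩ : ∃ y, y = b * x * b⁻¹ := ⟨_, rfl⟩
  obtain ⟨u, hu⟩ : ∃ u, u = b * a⁻¹ := ⟨_, rfl⟩
  obtain ⟨v, hv⟩ : ∃ v, v = a * (b * a⁻¹) * a⁻¹ := ⟨_, rfl⟩
  have hax : a * x * a⁻¹ = x := by rw [hx, ← mul_assoc, hac.eq]; group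
  have hcb : c⁻¹ * b * c = b * c * b⁻¹ := braid_inv_mul_mul hbc
  have hba : a⁻¹ * b * a = b * a * b⁻¹ := braid_inv_mul_mul hab.symm
  have hi : a⁻¹ * b⁻¹ * a⁻¹ = b⁻¹ * a⁻¹ * b⁻¹ := by
    have := congrArg (·⁻¹) hab
    simpa only [mul_inv_rev, ← mul_assoc] using this
  have hay : a * y * a⁻¹ = x⁻¹ * y :=
    calc a * y * a⁻¹ = a * b * c * (a⁻¹ * b⁻¹ * a⁻¹) := by rw [hy, hx]; group
      _ = a * (b * c * b⁻¹) * a⁻¹ * b⁻¹ := by rw [hi]; group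
      _ = x⁻¹ * y := by rw [← hcb, hy, hx]; group
  have hby : b * y * b⁻¹ = y * x⁻¹ * y := by
    have hb' : a⁻¹ * b⁻¹ * a = b * a⁻¹ * b⁻¹ := by
      have := congrArg (·⁻¹) hba
      simpa only [mul_inv_rev, ← mul_assoc, inv_inv] using this
    have h1 : x * (b⁻¹ * x⁻¹ * b) * x = b * x * b⁻¹ :=
      calc x * (b⁻¹ * x⁻¹ * b) * x
          = c * (a⁻¹ * b⁻¹ * a) * (c⁻¹ * b * c) * a⁻¹ := by rw [hx]; group
        _ = c * b * (a⁻¹ * c) * b⁻¹ * a⁻¹ := by rw [hb', hcb]; group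
        _ = (c * b * c) * (a⁻¹ * b⁻¹ * a⁻¹) := by rw [hac.inv_left.eq]; group
        _ = b * x * b⁻¹ := by rw [← hbc, hi, hx]; group
    calc b * y * b⁻¹ = b * (b * x * b⁻¹) * b⁻¹ := by rw [hy]
      _ = b * (x * (b⁻¹ * x⁻¹ * b) * x) * b⁻¹ := by rw [h1]
      _ = y * x⁻¹ * y := by rw [hy]; group
  have hay' : a⁻¹ * y * a = x * y := by
    have : a * (x * y) * a⁻¹ = y :=
      calc a * (x * y) * a⁻¹ = (a * x * a⁻¹) * (a * y * a⁻¹) := by group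
        _ = y := by rw [hax, hay]; group
    nth_rw 1 [← this]; group
  have hax' : a⁻¹ * x * a = x := by
    nth_rw 1 [← hax]; group
  have hux : MulAut.conj u x = y := by
    rw [MulAut.conj_apply, hu]
    calc b * a⁻¹ * x * (b * a⁻¹)⁻¹ = b * (a⁻¹ * x * a) * b⁻¹ := by group
      _ = y := by rw [hax', hy]
  have huy : MulAut.conj u y = y * y * x⁻¹ * y := by
    rw [MulAut.conj_apply, hu]
    calc b * a⁻¹ * y * (b * a⁻¹)⁻¹ = b * (a⁻¹ * y * a) * b⁻¹ := by group
      _ = (b * x * b⁻¹) * (b * y * b⁻¹) := by rw [hay']; group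
      _ = y * y * x⁻¹ * y := by rw [hby, ← hy]; group
  have hva : ∀ g, MulAut.conj v g = a * (MulAut.conj u (a⁻¹ * g * a)) * a⁻¹ := by
    intro g; simp [MulAut.conj_apply, hu, hv, mul_assoc]
  have hvx : MulAut.conj v x = x⁻¹ * y := by rw [hva, hax', hux, hay]
  have hvy : MulAut.conj v y = x⁻¹ * y * (x⁻¹ * y) * (x⁻¹ * y) * x⁻¹ * (x⁻¹ * y) := by
    rw [hva, hay', map_mul, hux, huy]
    calc a * (y * (y * y * x⁻¹ * y)) * a⁻¹ = (a * y * a⁻¹) * (a * y * a⁻¹) * (a * y * a⁻¹) *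
          (a * x * a⁻¹)⁻¹ * (a * y * a⁻¹) := by group
      _ = _ := by rw [hax, hay]
  have hcomm : ∀ g, MulAut.conj u (MulAut.conj v g) = MulAut.conj v (MulAut.conj u g) := by
    intro g
    rw [← hv, ← hu] at huv
    rw [← MulAut.mul_apply, ← map_mul, huv.eq, map_mul, MulAut.mul_apply]
  -- The two orders of conjugating by `u` and `v` agree. On `x` this yields a second value for the
  -- conjugate of `y` by `v`; on `y` it makes `x` and `y` commute. Comparison with `hvy` then gives
  -- `x ^ 4 = y ^ 2`.
  have r1 : MulAut.conj v y = y * x⁻¹ * y := by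
    rw [← hux, ← hcomm, hvx, map_mul, map_inv, hux, huy]; group
  have r2 : Commute x y := by
    have h2 := hcomm y
    simp only [r1, huy, map_mul, map_inv, hux, hvx] at h2
    have h3 : y * x⁻¹ = x⁻¹ * y := by
      have h4 : y * (y * x⁻¹) * (y * y * x⁻¹ * y) = y * (x⁻¹ * y) * (y * y * x⁻¹ * y) :=
        calc _ = y * y * x⁻¹ * y * y⁻¹ * (y * y * x⁻¹ * y) := by group
          _ = _ := by rw [h2]; group
      exact mul_left_cancel (mul_right_cancel h4)
    have : Commute y x⁻¹ := h3
    exact (Commute.inv_right_iff.1 this).symm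
  have r3 : x ^ 4 = y ^ 2 := by
    rw [hvy] at r1
    have e : ∀ {g h k l : G}, g = h → l * g * k = l * h * k := by rintro _ _ _ _ rfl; rfl
    have e1 : x⁻¹ * y * (x⁻¹ * y) * (x⁻¹ * y) * x⁻¹ * (x⁻¹ * y) = x⁻¹ ^ 5 * y ^ 4 := by
      have hxy : y * x⁻¹ = x⁻¹ * y := (r2.inv_left.eq).symm
      have hp : (x⁻¹ * y) ^ 3 = x⁻¹ ^ 3 * y ^ 3 := r2.inv_left.mul_pow 3
      have hq : Commute (x⁻¹ ^ 2) (y ^ 3) := (r2.inv_left.pow_pow 2 3)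
      calc _ = (x⁻¹ * y) ^ 3 * x⁻¹ ^ 2 * y := by simp only [pow_succ, pow_zero, one_mul, mul_assoc]
        _ = x⁻¹ ^ 3 * (y ^ 3 * x⁻¹ ^ 2) * y := by rw [hp]; simp only [mul_assoc]
        _ = x⁻¹ ^ 5 * y ^ 4 := by rw [← hq.eq]; group
    have e2 : y * x⁻¹ * y = x⁻¹ * y ^ 2 := by rw [← r2.inv_left.eq, pow_two, mul_assoc]
    rw [e1, e2] at r1
    have := e (k := y⁻¹ ^ 2) (l := x ^ 5) r1
    calc x ^ 4 = x ^ 5 * (x⁻¹ * y ^ 2) * y⁻¹ ^ 2 := by group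
      _ = x ^ 5 * (x⁻¹ ^ 5 * y ^ 4) * y⁻¹ ^ 2 := by rw [this]
      _ = y ^ 2 := by group
  -- Conjugate `x ^ 4 = y ^ 2` by `u`, which sends `x` to `y` and `y` to `y ^ 3 * x⁻¹`.
  have r4 : y ^ 4 = y ^ 6 * x⁻¹ ^ 2 := by
    have := congrArg (MulAut.conj u) r3
    rw [map_pow, map_pow, hux, huy] at this
    rw [this]
    have e2 : y * y * x⁻¹ * y = y ^ 3 * x⁻¹ := by
      rw [mul_assoc, r2.inv_left.eq, ← mul_assoc]
      simp only [pow_succ, pow_zero, one_mul]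
    rw [e2, ((r2.symm.inv_right).pow_left 3).mul_pow, ← pow_mul]
  have r5 : x ^ 2 = y ^ 2 := by
    calc x ^ 2 = (y ^ 4)⁻¹ * y ^ 4 * x ^ 2 := by group
      _ = (y ^ 4)⁻¹ * (y ^ 6 * x⁻¹ ^ 2) * x ^ 2 := by rw [← r4]
      _ = y ^ 2 := by group
  have r6 : x ^ 2 = 1 := by
    have : x ^ 2 * x ^ 2 = x ^ 2 := by rw [← pow_add, r3, r5]
    simpa using this
  rw [hx, (hac.symm.inv_right).mul_pow, inv_pow, mul_inv_eq_one] at r6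
  exact r6.symm

theorem braid_half_twist_mul_left (h : a * b * a = b * a * b) :
    a * b * a * a = b * (a * b * a) := by
  nth_rw 1 [h]; simp only [mul_assoc]

theorem braid_half_twist_mul_right (h : a * b * a = b * a * b) :
    a * b * a * b = a * (a * b * a) := by
  nth_rw 2 [h]; simp only [mul_assoc]

theorem braid_full_twist_commute_left (h : a * b * a = b * a * b) :
    Commute ((a * b * a) * (a * b * a)) a := by
  rw [commute_iff_eq, mul_assoc, braid_half_twist_mul_left h, ← mul_assoc,
    braid_half_twist_mul_right h, mul_assoc]

theorem braid_full_twist_commute_right (h : a * b * a = b * a * b) :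
    Commute ((a * b * a) * (a * b * a)) b := by
  rw [commute_iff_eq, mul_assoc, braid_half_twist_mul_right h, ← mul_assoc,
    braid_half_twist_mul_left h, mul_assoc]

/-- The half twist D = `a * b * a` interchanges `a` and `b`. Since ab = Da⁻¹ and ba = a⁻¹D, the
product is Da⁻²D = b⁻², which is b² because b⁴ = 1. -/
theorem braid_mul_sq_mul (h : a * b * a = b * a * b) (hD : (a * b * a) * (a * b * a) = 1)
    (ha : a ^ 4 = 1) : a * b ^ 2 * a = b ^ 2 := by
  obtain ⟨D, hDdef⟩ : ∃ D, D = a * b * a := ⟨_, rfl⟩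
  have hDa : SemiconjBy D a b := by
    rw [hDdef]; exact braid_half_twist_mul_left h
  rw [← hDdef] at hD
  have hb : b ^ 4 = 1 := by
    have := (hDa.pow_right 4).eq
    rw [ha, mul_one] at this
    exact (right_eq_mul.1 this)
  have hba : b * a = a⁻¹ * D := by rw [hDdef]; group
  have hab : a * b = D * a⁻¹ := by rw [hDdef]; group
  calc a * b ^ 2 * a = (a * b) * (b * a) := by simp only [pow_two, mul_assoc]
    _ = D * (a ^ 2)⁻¹ * D := by rw [hab, hba, pow_two, mul_inv_rev]; simp only [mul_assoc]
    _ = (b ^ 2)⁻¹ := by rw [((hDa.pow_right 2).inv_right).eq, mul_assoc, hD, mul_one]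
    _ = b ^ 2 := by rw [inv_eq_iff_mul_eq_one, ← pow_add, hb]

end BraidRelation

/-! ### Counting cosets -/

section Counting

variable {G : Type*} [Group G]

theorem card_mul_card_le_of_transversal [Finite G] {L M : Subgroup G} (hLM : L ≤ M) {ι : Type*}
    [Fintype ι] (f : ι → G) (hf : ∀ i, f i ∈ M) (hd : ∀ i j, i ≠ j → (f i)⁻¹ * f j ∉ L) :
    Fintype.card ι * Nat.card L ≤ Nat.card M := by
  rw [← Nat.card_eq_fintype_card, ← Nat.card_prod]
  refine Nat.card_le_card_of_injective
    (fun p : ι × L => (⟨f p.1 * p.2, M.mul_mem (hf _) (hLM p.2.2)⟩ : M)) ?_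
  rintro ⟨i, x⟩ ⟨j, y⟩ h
  have h' : f i * x = f j * y := congrArg Subtype.val h
  have hij : i = j := by
    by_contra hne
    refine hd i j hne ?_
    have : (f i)⁻¹ * f j = x * (y : G)⁻¹ := by
      rw [inv_mul_eq_iff_eq_mul, ← mul_assoc, h', mul_inv_cancel_right]
    rw [this]
    exact L.mul_mem x.2 (L.inv_mem y.2)
  subst hij
  simpa using h'

/-- The left cosets of `1`, `b` and `a * b` are distinct: `b⁻¹ * a * b = a * b * a⁻¹` could lie in
`L` only if `b` did. -/
theorem three_mul_card_le_of_braid [Finite G] {L M : Subgroup G} (hLM : L ≤ M) {a b : G}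
    (h : a * b * a = b * a * b) (ha : a ∈ L) (hbM : b ∈ M) (hb : b ∉ L) :
    3 * Nat.card L ≤ Nat.card M := by
  have haM := hLM ha
  have h1 : b⁻¹ * (a * b) ∉ L := by
    rw [← mul_assoc, braid_inv_mul_mul h]
    rwa [Subgroup.mul_mem_cancel_right _ (L.inv_mem ha), Subgroup.mul_mem_cancel_left _ ha]
  have h2 : (b⁻¹ * (a * b))⁻¹ ∉ L := by rwa [L.inv_mem_iff]
  have h3 : a * b ∉ L := by rwa [Subgroup.mul_mem_cancel_left _ ha]
  have h4 : (a * b)⁻¹ ∉ L := by rwa [L.inv_mem_iff]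
  have h5 : b⁻¹ ∉ L := by rwa [L.inv_mem_iff]
  refine card_mul_card_le_of_transversal hLM (![1, b, a * b] : Fin 3 → G) ?_ ?_
  · intro i; fin_cases i
    exacts [M.one_mem, hbM, M.mul_mem haM hbM]
  · intro i j hij
    fin_cases i <;> fin_cases j <;> first | exact absurd rfl hij | skip
    all_goals simp only [mul_inv_rev, inv_inv] at h2 h4
    all_goals simp_all

theorem commute_of_mem_zpowers {a x : G} (hx : x ∈ Subgroup.zpowers a) : Commute x a := by
  obtain ⟨k, rfl⟩ := hx
  exact (Commute.refl a).zpow_left k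

theorem braid_commute_zpow_swap {a b : G} (h : a * b * a = b * a * b) {k : ℤ}
    (hc : Commute (b ^ k) a) : Commute (a ^ k) b := by
  obtain ⟨f, hf⟩ : ∃ f : G ≃* G, f = MulAut.conj (a * b * a) := ⟨_, rfl⟩
  have ha : f a = b := by
    rw [hf, MulAut.conj_apply, mul_inv_eq_iff_eq_mul, braid_half_twist_mul_left h]
  have hb : f b = a := by
    rw [hf, MulAut.conj_apply, mul_inv_eq_iff_eq_mul, braid_half_twist_mul_right h]
  refine f.injective ?_
  rw [map_mul, map_mul, map_zpow, ha, hb]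
  exact hc.eq

theorem braid_inv_zpow_mul {a b : G} (h : a * b * a = b * a * b) (k : ℤ) :
    b⁻¹ * a ^ k * b = a * b ^ k * a⁻¹ := by
  have := conj_zpow (a := b⁻¹) (b := a) (i := k)
  rw [inv_inv] at this
  rw [← this, braid_inv_mul_mul h, conj_zpow]

/-- The conjugate equals `a * b ^ k * a⁻¹`, so `b ^ k` is a power of `a`. The half twist then
exchanges the roles of `a` and `b`. -/
theorem braid_commute_of_conj_mem {a b : G} (h : a * b * a = b * a * b) {k : ℤ}
    (hm : b⁻¹ * a ^ k * b ∈ Subgroup.zpowers a) : Commute (a ^ k) b := by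
  have ha := Subgroup.mem_zpowers a
  rw [braid_inv_zpow_mul h, Subgroup.mul_mem_cancel_right _ (Subgroup.inv_mem _ ha),
    Subgroup.mul_mem_cancel_left _ ha] at hm
  exact braid_commute_zpow_swap h (commute_of_mem_zpowers hm)

/-- A lower bound for the order of a finite group containing two elements that satisfy the braid
relation, excluding small degenerate configurations. -/
theorem card_ge_of_braid [Finite G] {a b : G} (h : a * b * a = b * a * b)
    (h2 : ¬ Commute (a ^ 2) b) (huv : ¬ Commute (b * a⁻¹) (a * (b * a⁻¹) * a⁻¹)) :
    21 ≤ Nat.card G := by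
  have hL : Nat.card (Subgroup.zpowers a) = orderOf a := Nat.card_zpowers a
  have ha := Subgroup.mem_zpowers a
  have h1 : ¬ Commute a b := fun hc => h2 (hc.pow_left 2)
  have hz1 : ¬ Commute (a ^ (1 : ℤ)) b := by simpa using h1
  have hz2 : ¬ Commute (a ^ (2 : ℤ)) b := by exact_mod_cast h2
  have hneg : ∀ {k : ℤ}, ¬ Commute (a ^ k) b → ¬ Commute (a ^ (-k)) b := by
    intro k hk hc
    rw [zpow_neg, Commute.inv_left_iff] at hc
    exact hk hc
  have hbL : b ∉ Subgroup.zpowers a := fun hb => h1 (commute_of_mem_zpowers hb).symm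
  have hpos : 0 < orderOf a := orderOf_pos a
  -- The cosets of `a ^ i * b` modulo ⟨a⟩, for i < m, are distinct as long as no `a ^ k` with 0 < k
  -- < m commutes with `b`. The coset of `1` is one more. The order of `a` decides how many cosets
  -- are needed to reach 21.
  have key : ∀ m : ℕ, (∀ k : ℤ, 0 < k → k < m → ¬ Commute (a ^ k) b) →
      ∀ i j : Fin m, i ≠ j → (a ^ (i : ℤ) * b)⁻¹ * (a ^ (j : ℤ) * b) ∉ Subgroup.zpowers a := by
    intro m hm i j hij hmem
    have e : (a ^ (i : ℤ) * b)⁻¹ * (a ^ (j : ℤ) * b) = b⁻¹ * a ^ ((j : ℤ) - i) * b := by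
      rw [sub_eq_neg_add, zpow_add, zpow_neg]; simp only [mul_inv_rev, mul_assoc]
    rw [e] at hmem
    have hc := braid_commute_of_conj_mem h hmem
    have hne : (i : ℤ) ≠ j := by simpa [Fin.ext_iff] using hij
    rcases lt_or_gt_of_ne hne with hlt | hlt
    · exact hm _ (by omega) (by omega) hc
    · refine hm ((i : ℤ) - j) (by omega) (by omega) ?_
      rw [show (i : ℤ) - j = -((j : ℤ) - i) by ring, zpow_neg]
      exact hc.inv_left
  have hone : ∀ i : ℤ, a ^ i * b ∉ Subgroup.zpowers a := fun i hi => hbL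
    ((Subgroup.mul_mem_cancel_left _ (Subgroup.zpow_mem _ ha i)).1 hi)
  have key' : ∀ m : ℕ, (∀ k : ℤ, 0 < k → k < m → ¬ Commute (a ^ k) b) →
      (m + 1) * orderOf a ≤ Nat.card G := by
    intro m hm
    have := card_mul_card_le_of_transversal (L := Subgroup.zpowers a) (M := ⊤) le_top
      (fun o : Option (Fin m) => o.elim 1 fun i => a ^ (i : ℤ) * b) (fun _ => Subgroup.mem_top _)
      (by
        rintro (_ | i) (_ | j) hij
        · exact absurd rfl hij
        · simpa using hone j
        · intro hmem
          refine hone i ?_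
          simpa using Subgroup.inv_mem _ hmem
        · exact key m hm i j (by simpa using hij))
    simpa [hL, Subgroup.card_top] using this
  have hN1 : orderOf a ≠ 1 := fun hc => h1 (by
    rw [orderOf_eq_one_iff.1 hc]; exact Commute.one_left b)
  have hN2 : orderOf a ≠ 2 := fun hc => h2 (by
    rw [← hc, pow_orderOf_eq_one]; exact Commute.one_left b)
  have h3lt : ∀ k : ℤ, 0 < k → k < (3 : ℕ) → ¬ Commute (a ^ k) b := by
    intro k hk hk'
    obtain rfl | rfl : k = 1 ∨ k = 2 := by omega
    exacts [hz1, hz2]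
  rcases le_or_gt 6 (orderOf a) with h6 | h6
  -- Four cosets of at least 6 elements each.
  · have := key' 3 h3lt
    omega
  obtain hN | hN | hN : orderOf a = 5 ∨ orderOf a = 4 ∨ orderOf a = 3 := by omega
  -- In order 5, `a` is the square of `a ^ 3`, so `a ^ 3` does not commute with `b` either: five
  -- cosets, 25 elements.
  · have h4lt : ∀ k : ℤ, 0 < k → k < (4 : ℕ) → ¬ Commute (a ^ k) b := by
      intro k hk hk'
      obtain hk3 | rfl : k < (3 : ℕ) ∨ k = 3 := by omega
      · exact h3lt k hk hk3
      · intro hc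
        have e : (a ^ (3 : ℤ)) ^ 2 = a := by
          have : a ^ 5 = 1 := by rw [← hN, pow_orderOf_eq_one]
          calc (a ^ (3 : ℤ)) ^ 2 = a ^ 5 * a := by group
            _ = a := by rw [this, one_mul]
        exact h1 (e ▸ hc.pow_left 2)
    have := key' 4 h4lt
    omega
  · have ha4 : a ^ 4 = 1 := by rw [← hN, pow_orderOf_eq_one]
    have h4lt : ∀ k : ℤ, 0 < k → k < (4 : ℕ) → ¬ Commute (a ^ k) b := by
      intro k hk hk'
      obtain hk3 | rfl : k < (3 : ℕ) ∨ k = 3 := by omega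
      · exact h3lt k hk hk3
      · have e : a ^ (3 : ℤ) = a ^ (-1 : ℤ) := by
          calc a ^ (3 : ℤ) = a ^ 4 * a ^ (-1 : ℤ) := by group
            _ = _ := by rw [ha4, one_mul]
        rw [e]
        exact hneg hz1
    -- In order 4 the five cosets give only 20, so a sixth is sought. A coset of such a `g` is fixed
    -- by left multiplication by `a`, whereas those of `a ^ i * b` are not. The full twist serves as
    -- `g` unless it lies in ⟨a⟩; in that case it is trivial and `b ^ 2` inverts `a`.
    obtain ⟨g, hgL, hg⟩ : ∃ g, g ∉ Subgroup.zpowers a ∧ g⁻¹ * a * g ∈ Subgroup.zpowers a := by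
      have hD2a := braid_full_twist_commute_left h
      have hD2b := braid_full_twist_commute_right h
      by_cases hD : (a * b * a) * (a * b * a) ∈ Subgroup.zpowers a
      · have hD1 : (a * b * a) * (a * b * a) = 1 := by
          obtain ⟨k, hk⟩ := hD
          have hk' : a ^ k = (a * b * a) * (a * b * a) := hk
          have hmod : a ^ k = a ^ (k % 4) := by
            rw [← zpow_mod_orderOf, hN]; rfl
          rw [← hk', hmod]
          rcases (show k % 4 = 0 ∨ (0 < k % 4 ∧ k % 4 < 4) by omega) with h0 | ⟨h0, h0'⟩
          · rw [h0, zpow_zero]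
          · exact absurd (by rw [← hmod, hk']; exact hD2b) (h4lt _ h0 (by exact_mod_cast h0'))
        have hab := braid_mul_sq_mul h hD1 ha4
        refine ⟨b ^ 2, fun hb2 => h2 ?_, ?_⟩
        · exact braid_commute_pow_symm h (commute_of_mem_zpowers hb2)
        · have : (b ^ 2)⁻¹ * a * b ^ 2 = a⁻¹ := by
            rw [mul_assoc, inv_mul_eq_iff_eq_mul, eq_mul_inv_iff_mul_eq, hab]
          rw [this]
          exact Subgroup.inv_mem _ ha
      · refine ⟨_, hD, ?_⟩
        rw [mul_assoc, ← hD2a.eq, inv_mul_cancel_left]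
        exact ha
    have hfix : ∀ i : ℤ, g⁻¹ * (a ^ i * b) ∉ Subgroup.zpowers a := by
      intro i hi
      have h0 : b⁻¹ * a ^ (1 : ℤ) * b ∈ Subgroup.zpowers a := by
        have : b⁻¹ * a ^ (1 : ℤ) * b =
            (g⁻¹ * (a ^ i * b))⁻¹ * (g⁻¹ * a * g) * (g⁻¹ * (a ^ i * b)) := by
          simp only [mul_inv_rev, inv_inv]; group
        rw [this]
        exact Subgroup.mul_mem _ (Subgroup.mul_mem _ (Subgroup.inv_mem _ hi) hg) hi
      exact hz1 (braid_commute_of_conj_mem h h0)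
    have := card_mul_card_le_of_transversal (L := Subgroup.zpowers a) (M := ⊤) le_top
      (fun o : Option (Option (Fin 4)) => o.elim g fun o => o.elim 1 fun i => a ^ (i : ℤ) * b)
      (fun _ => Subgroup.mem_top _)
      (by
        rintro (_ | _ | i) (_ | _ | j) hij
        · exact absurd rfl hij
        · simpa using hgL
        · exact hfix j
        · simpa using hgL
        · exact absurd rfl hij
        · simpa using hone j
        · intro hmem
          refine hfix i ?_
          simpa [mul_assoc] using Subgroup.inv_mem _ hmem
        · intro hmem
          refine hone i ?_
          simpa using Subgroup.inv_mem _ hmem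
        · exact key 4 h4lt i j (by simpa using hij))
    simp only [hL, Subgroup.card_top, Fintype.card_option, Fintype.card_fin] at this
    omega
  · have ha3 : a ^ 3 = 1 := by rw [← hN, pow_orderOf_eq_one]
    -- In order 3 the seven cosets of `1`, `a ^ i * b` and `a ^ i * b⁻¹` give exactly 21. The
    -- delicate point is to separate the two families. If `b * a⁻¹ * b` were in ⟨a⟩, the squares of
    -- u = `b * a⁻¹`, v = `a * u * a⁻¹` and `v * u⁻¹` would all be trivial, so u and v would
    -- commute.
    have hba : b * a⁻¹ * b ∉ Subgroup.zpowers a := by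
      intro hm
      have hu2 : (b * a⁻¹) ^ 2 ∈ Subgroup.zpowers a := by
        have : (b * a⁻¹) ^ 2 = b * a⁻¹ * b * a⁻¹ := by simp only [pow_two, mul_assoc]
        rw [this]
        exact Subgroup.mul_mem _ hm (Subgroup.inv_mem _ ha)
      have hu1 : (b * a⁻¹) ^ 2 = 1 := by
        obtain ⟨k, hk⟩ := hu2
        have hk' : a ^ k = (b * a⁻¹) ^ 2 := hk
        have hmod : a ^ k = a ^ (k % 3) := by
          rw [← zpow_mod_orderOf, hN]; rfl
        rw [← hk', hmod]
        rcases (show k % 3 = 0 ∨ (0 < k % 3 ∧ k % 3 < 3) by omega) with h0 | ⟨h0, h0'⟩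
        · rw [h0, zpow_zero]
        · refine absurd ?_ (h3lt _ h0 (by exact_mod_cast h0'))
          rw [← hmod]
          have c1 : Commute (a ^ k) (b * a⁻¹) := by rw [hk']; exact Commute.pow_self _ 2
          have c2 : Commute (a ^ k) a := (Commute.refl a).zpow_left k
          simpa using c1.mul_right c2
      refine huv ?_
      obtain ⟨u, hu⟩ : ∃ u, u = b * a⁻¹ := ⟨_, rfl⟩
      obtain ⟨v, hv⟩ : ∃ v, v = a * (b * a⁻¹) * a⁻¹ := ⟨_, rfl⟩
      rw [← hv, ← hu]
      rw [← hu] at hu1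
      have hv1 : v ^ 2 = 1 := by rw [hv, ← hu, conj_pow, hu1]; simp
      have hw : v * u⁻¹ = (a⁻¹ * u * a)⁻¹ := by
        rw [hv, hu]
        calc a * (b * a⁻¹) * a⁻¹ * (b * a⁻¹)⁻¹ = (a * b * a⁻¹) * b⁻¹ := by group
          _ = (a⁻¹ * (b * a⁻¹) * a)⁻¹ := by rw [← braid_inv_mul_mul h]; group
      have hw1 : (v * u⁻¹) ^ 2 = 1 := by
        have := conj_pow (a := a⁻¹) (b := u) (i := 2)
        rw [inv_inv] at this
        rw [hw, inv_pow, this, hu1]; simp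
      have hui : u⁻¹ = u := by rw [inv_eq_iff_mul_eq_one, ← pow_two, hu1]
      have hvi : v⁻¹ = v := by rw [inv_eq_iff_mul_eq_one, ← pow_two, hv1]
      rw [hui, pow_two, mul_eq_one_iff_eq_inv, mul_inv_rev, hui, hvi] at hw1
      exact hw1.symm
    have hb2 : b ^ 2 ∉ Subgroup.zpowers a := fun hb2 => h2
      (braid_commute_pow_symm h (commute_of_mem_zpowers hb2))
    have hbab : ∀ k : ℤ, b * a ^ k * b ∉ Subgroup.zpowers a := by
      intro k
      have hmod : a ^ k = a ^ (k % 3) := by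
        rw [← zpow_mod_orderOf, hN]; rfl
      rw [hmod]
      obtain h0 | h0 | h0 : k % 3 = 0 ∨ k % 3 = 1 ∨ k % 3 = 2 := by omega
      · rw [h0, zpow_zero, mul_one, ← pow_two]; exact hb2
      · rw [h0, zpow_one, ← h, Subgroup.mul_mem_cancel_right _ ha,
          Subgroup.mul_mem_cancel_left _ ha]
        exact hbL
      · have e : a ^ (2 : ℤ) = a⁻¹ := by
          rw [eq_inv_iff_mul_eq_one, ← ha3]; group
        rw [h0, e]; exact hba
    have hconj : ∀ k : ℤ, b * a ^ k * b⁻¹ ∈ Subgroup.zpowers a → Commute (a ^ k) b := by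
      intro k hk
      have e : b * a ^ k * b⁻¹ = a⁻¹ * b ^ k * a := by
        have h' := braid_inv_mul_mul h.symm
        have := conj_zpow (a := a⁻¹) (b := b) (i := k)
        rw [inv_inv] at this
        rw [← this, h', conj_zpow]
      rw [e, Subgroup.mul_mem_cancel_right _ ha,
        Subgroup.mul_mem_cancel_left _ (Subgroup.inv_mem _ ha)] at hk
      exact braid_commute_zpow_swap h (commute_of_mem_zpowers hk)
    have hone' : ∀ i : ℤ, a ^ i * b⁻¹ ∉ Subgroup.zpowers a := fun i hi => hbL (by
      rwa [Subgroup.mul_mem_cancel_left _ (Subgroup.zpow_mem _ ha i), Subgroup.inv_mem_iff] at hi)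
    have := card_mul_card_le_of_transversal (L := Subgroup.zpowers a) (M := ⊤) le_top
      (fun o : Option (Fin 3 ⊕ Fin 3) => o.elim 1 (Sum.elim (fun i => a ^ (i : ℤ) * b)
        fun i => a ^ (i : ℤ) * b⁻¹))
      (fun _ => Subgroup.mem_top _)
      (by
        rintro (_ | i | i) (_ | j | j) hij
        · exact absurd rfl hij
        · simpa using hone j
        · simpa using hone' j
        · intro hmem
          refine hone i ?_
          simpa using Subgroup.inv_mem _ hmem
        · exact key 3 h3lt i j (by simpa using hij)
        · intro hmem
          refine hbab ((i : ℤ) - j) ?_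
          have e : b * a ^ ((i : ℤ) - j) * b =
              ((a ^ (i : ℤ) * b)⁻¹ * (a ^ (j : ℤ) * b⁻¹))⁻¹ := by
            rw [sub_eq_neg_add, zpow_add, zpow_neg]; simp [mul_assoc]
          rw [e]
          exact Subgroup.inv_mem _ hmem
        · intro hmem
          refine hone' i ?_
          simpa using Subgroup.inv_mem _ hmem
        · intro hmem
          refine hbab ((j : ℤ) - i) ?_
          have e : b * a ^ ((j : ℤ) - i) * b = (a ^ (i : ℤ) * b⁻¹)⁻¹ * (a ^ (j : ℤ) * b) := by
            rw [sub_eq_neg_add, zpow_add, zpow_neg]; simp [mul_assoc]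
          rw [e]
          exact hmem
        · intro hmem
          have e : (a ^ (i : ℤ) * b⁻¹)⁻¹ * (a ^ (j : ℤ) * b⁻¹) = b * a ^ ((j : ℤ) - i) * b⁻¹ := by
            rw [sub_eq_neg_add, zpow_add, zpow_neg]; simp [mul_assoc]
          simp only [Option.elim, Sum.elim_inr] at hmem
          rw [e] at hmem
          have hc := hconj _ hmem
          have hne : (i : ℤ) ≠ j := by simpa [Fin.ext_iff] using hij
          have hi := i.2
          have hj := j.2
          rcases lt_or_gt_of_ne hne with hlt | hlt
          · exact h3lt _ (by omega) (by omega) hc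
          · refine h3lt ((i : ℤ) - j) (by omega) (by omega) ?_
            rw [show (i : ℤ) - j = -((j : ℤ) - i) by ring, zpow_neg]
            exact hc.inv_left)
    simp only [hL, Subgroup.card_top, Fintype.card_option, Fintype.card_sum, Fintype.card_fin]
      at this
    omega

/-- Distinct cosets of a subgroup containing all but the last of a sequence of braid generators. -/
theorem exists_braid_transversal (m : ℕ) (s : ℕ → G)
    (hbr : ∀ i, i < m + 2 → s i * s (i + 1) * s i = s (i + 1) * s i * s (i + 1))
    (hcm : ∀ i j, i + 2 ≤ j → j ≤ m + 2 → Commute (s i) (s j)) (L : Subgroup G)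
    (hL : ∀ i, i < m + 2 → s i ∈ L) (hsq : s (m + 2) ^ 2 ∉ L) :
    ∃ (ι : Type) (_ : Fintype ι) (f : ι → G), Fintype.card ι = m + 6 ∧
      (∀ i, f i ∈ Subgroup.closure (s '' Set.Iic (m + 2))) ∧
      ∀ i j, i ≠ j → (f i)⁻¹ * f j ∉ L := by
  induction m generalizing L with
  | zero =>
    obtain ⟨a, ha⟩ : ∃ a, a = s 0 := ⟨_, rfl⟩
    obtain ⟨b, hb⟩ : ∃ b, b = s 1 := ⟨_, rfl⟩
    obtain ⟨c, hc⟩ : ∃ c, c = s 2 := ⟨_, rfl⟩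
    have hab : a * b * a = b * a * b := by rw [ha, hb]; exact hbr 0 (by omega)
    have hbc : b * c * b = c * b * c := by rw [hb, hc]; exact hbr 1 (by omega)
    have hac : Commute a c := by rw [ha, hc]; exact hcm 0 2 (by omega) (by omega)
    have haL : a ∈ L := ha ▸ hL 0 (by omega)
    have hbL : b ∈ L := hb ▸ hL 1 (by omega)
    have hc2 : c ^ 2 ∉ L := hc ▸ hsq
    have hc1 : c ∉ L := fun h => hc2 (L.pow_mem h 2)
    have hmem : ∀ i, i ≤ 2 → s i ∈ Subgroup.closure (s '' Set.Iic (0 + 2)) :=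
      fun i hi => Subgroup.subset_closure ⟨i, by simpa using hi, rfl⟩
    have haS := hmem 0 (by omega)
    have hbS := hmem 1 (by omega)
    have hcS := hmem 2 (by omega)
    rw [← ha] at haS
    rw [← hb] at hbS
    rw [← hc] at hcS
    have hck : ∀ k : ℤ, k = 1 ∨ k = 2 ∨ k = -1 ∨ k = -2 → c ^ k ∉ L := by
      rintro k (rfl | rfl | rfl | rfl)
      · simpa using hc1
      · exact_mod_cast hc2
      · simpa using hc1
      · rw [zpow_neg, L.inv_mem_iff]; exact_mod_cast hc2
    have hconj : ∀ k : ℤ, k = 1 ∨ k = 2 ∨ k = -1 ∨ k = -2 → c⁻¹ * b⁻¹ * a ^ k * b * c ∉ L := by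
      intro k hk
      have e : c⁻¹ * b⁻¹ * a ^ k * b * c = a * b * c ^ k * b⁻¹ * a⁻¹ := by
        calc c⁻¹ * b⁻¹ * a ^ k * b * c = c⁻¹ * (b⁻¹ * a ^ k * b) * c := by simp only [mul_assoc]
          _ = (c⁻¹ * a) * b ^ k * (a⁻¹ * c) := by
              rw [braid_inv_zpow_mul hab]; simp only [mul_assoc]
          _ = a * (c⁻¹ * b ^ k * c) * a⁻¹ := by
              rw [hac.inv_left.eq, ← hac.inv_right.eq]; simp only [mul_assoc]
          _ = _ := by rw [braid_inv_zpow_mul hbc]; simp only [mul_assoc]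
      rw [e, L.mul_mem_cancel_right (L.inv_mem haL), L.mul_mem_cancel_right (L.inv_mem hbL),
        L.mul_mem_cancel_left (L.mul_mem haL hbL)]
      exact hck k hk
    -- Left multiplication by `a` fixes the coset of `c ^ i` and moves that of `a ^ j * b * c`.
    have hmix : ∀ i j : ℤ, (c ^ i)⁻¹ * (a ^ j * b * c) ∉ L := by
      intro i j hij
      refine hconj 1 (Or.inl rfl) ?_
      have e : c⁻¹ * b⁻¹ * a ^ (1 : ℤ) * b * c =
          ((c ^ i)⁻¹ * (a ^ j * b * c))⁻¹ * ((c ^ i)⁻¹ * a * c ^ i) *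
            ((c ^ i)⁻¹ * (a ^ j * b * c)) := by
        simp only [mul_inv_rev, inv_inv]; group
      rw [e, mul_assoc (c ^ i)⁻¹ a, (hac.zpow_right i).eq, inv_mul_cancel_left]
      exact L.mul_mem (L.mul_mem (L.inv_mem hij) haL) hij
    refine ⟨Fin 3 ⊕ Fin 3, inferInstance,
      Sum.elim (fun i => c ^ (i : ℤ)) fun i => a ^ (i : ℤ) * b * c, by simp, ?_, ?_⟩
    · rintro (i | i)
      · exact Subgroup.zpow_mem _ hcS _
      · exact Subgroup.mul_mem _ (Subgroup.mul_mem _ (Subgroup.zpow_mem _ haS _) hbS) hcS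
    · rintro (i | i) (j | j) hij
      · have e : (c ^ (i : ℤ))⁻¹ * c ^ (j : ℤ) = c ^ ((j : ℤ) - i) := by
          rw [sub_eq_neg_add, zpow_add, zpow_neg]
        simp only [Sum.elim_inl]
        rw [e]
        have hne : (i : ℤ) ≠ j := by simpa [Fin.ext_iff] using hij
        exact hck _ (by omega)
      · exact hmix _ _
      · intro hm
        refine hmix j i ?_
        simpa [mul_assoc] using L.inv_mem hm
      · have e : (a ^ (i : ℤ) * b * c)⁻¹ * (a ^ (j : ℤ) * b * c) =
            c⁻¹ * b⁻¹ * a ^ ((j : ℤ) - i) * b * c := by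
          rw [sub_eq_neg_add, zpow_add, zpow_neg]; simp only [mul_inv_rev, mul_assoc]
        simp only [Sum.elim_inr]
        rw [e]
        have hne : (i : ℤ) ≠ j := by simpa [Fin.ext_iff] using hij
        exact hconj _ (by omega)
  | succ m ih =>
    have hs1 : s (m + 1 + 2) ∉ L := fun h => hsq (L.pow_mem h 2)
    obtain ⟨t, ht⟩ : ∃ t, t = s (m + 1 + 2) := ⟨_, rfl⟩
    rw [← ht] at hs1 hsq
    -- The induction hypothesis is applied to `t * L * t⁻¹`, which still contains the generators
    -- commuting with `t`. Its cosets become cosets of `L` after right multiplication by `t`, and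
    -- `L` itself is the additional one.
    have hmemC : ∀ x, x ∈ L.comap (MulAut.conj t⁻¹).toMonoidHom ↔ t⁻¹ * x * t ∈ L := by
      intro x; simp [Subgroup.mem_comap]
    obtain ⟨ι, hι, f, hcard, hf, hd⟩ := ih (fun i hi => hbr i (by omega))
      (fun i j hij hj => hcm i j hij (by omega)) (L.comap (MulAut.conj t⁻¹).toMonoidHom)
      (by
        intro i hi
        rw [hmemC, mul_assoc, (ht ▸ hcm i (m + 1 + 2) (by omega) le_rfl : Commute (s i) t).eq,
          inv_mul_cancel_left]
        exact hL i (by omega))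
      (by
        rw [hmemC]
        have h' : s (m + 2) * t * s (m + 2) = t * s (m + 2) * t := by
          rw [ht]; exact hbr (m + 2) (by omega)
        have := braid_inv_zpow_mul h' 2
        rw [zpow_ofNat, zpow_ofNat] at this
        have hm := hL (m + 2) (by omega)
        rw [this, L.mul_mem_cancel_right (L.inv_mem hm), L.mul_mem_cancel_left hm]
        exact hsq)
    have hle : Subgroup.closure (s '' Set.Iic (m + 2)) ≤ L := by
      rw [Subgroup.closure_le]
      rintro _ ⟨i, hi, rfl⟩
      have hi' : i ≤ m + 2 := hi
      exact hL i (by omega)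
    refine ⟨Option ι, inferInstance, fun o => o.elim 1 fun i => f i * t, by simp [hcard], ?_, ?_⟩
    · rintro (_ | i)
      · exact Subgroup.one_mem _
      · refine Subgroup.mul_mem _ (Subgroup.closure_mono (Set.image_mono ?_) (hf i)) ?_
        · intro x hx
          have : x ≤ m + 2 := hx
          exact (by omega : x ≤ m + 1 + 2)
        · rw [ht]
          exact Subgroup.subset_closure ⟨_, Set.mem_Iic.2 le_rfl, rfl⟩
    · have h1 : ∀ i, f i * t ∉ L := fun i h => hs1 ((L.mul_mem_cancel_left (hle (hf i))).1 h)
      rintro (_ | i) (_ | j) hij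
      · exact absurd rfl hij
      · simpa using h1 j
      · intro hm
        refine h1 i ?_
        simpa using L.inv_mem hm
      · intro hm
        refine hd i j (by simpa using hij) ?_
        rw [hmemC]
        simpa [mul_assoc] using hm

end Counting

/-! ### Powers of braid generators -/

section BraidSequence

variable {G : Type*} [Group G]

/-- Conjugation by `s k * s (k + 1) * s (k + 2)` shifts the pair at `k` to the pair at `k + 1`, so
equality of `m`-th powers at one place spreads in both directions. -/
theorem braid_sequence_pow_eq {N : ℕ} {s : ℕ → G}
    (hbr : ∀ i, i + 1 < N → s i * s (i + 1) * s i = s (i + 1) * s i * s (i + 1))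
    (hcm : ∀ i j, i + 2 ≤ j → j < N → Commute (s i) (s j)) {m i₀ : ℕ} (hi₀ : i₀ + 1 < N)
    (h : Commute (s i₀ ^ m) (s (i₀ + 1))) (i j : ℕ) (hi : i < N) (hj : j < N) :
    s i ^ m = s j ^ m := by
  have hshift : ∀ k, k + 2 < N → (s k ^ m = s (k + 1) ^ m ↔ s (k + 1) ^ m = s (k + 2) ^ m) := by
    intro k hk
    have h1 := hbr k (by omega)
    have h2 := hbr (k + 1) hk
    have h3 := hcm k (k + 2) le_rfl hk
    have e1 : MulAut.conj (s k * s (k + 1) * s (k + 2)) (s k) = s (k + 1) := by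
      rw [MulAut.conj_apply, mul_inv_eq_iff_eq_mul, mul_assoc _ (s (k + 2)), ← h3.eq, ← mul_assoc,
        h1]
      simp only [mul_assoc]
    have e2 : MulAut.conj (s k * s (k + 1) * s (k + 2)) (s (k + 1)) = s (k + 2) := by
      rw [MulAut.conj_apply, mul_inv_eq_iff_eq_mul]
      calc s k * s (k + 1) * s (k + 2) * s (k + 1)
          = s k * (s (k + 1) * s (k + 2) * s (k + 1)) := by simp only [mul_assoc]
        _ = (s k * s (k + 2)) * s (k + 1) * s (k + 2) := by
            rw [h2]; simp only [mul_assoc]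
        _ = _ := by rw [h3.eq]; simp only [mul_assoc]
    obtain ⟨f, hf⟩ : ∃ f : G ≃* G, f = MulAut.conj (s k * s (k + 1) * s (k + 2)) := ⟨_, rfl⟩
    rw [← hf] at e1 e2
    constructor <;> intro hk'
    · have := congrArg f hk'
      rwa [map_pow, map_pow, e1, e2] at this
    · refine f.injective ?_
      rw [map_pow, map_pow, e1, e2, hk']
  have h0 : s i₀ ^ m = s (i₀ + 1) ^ m := braid_pow_eq_of_commute (hbr i₀ hi₀) h
  have hall : ∀ k, k + 1 < N → s k ^ m = s (k + 1) ^ m := by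
    have hdown : ∀ d, d ≤ i₀ → s (i₀ - d) ^ m = s (i₀ - d + 1) ^ m := by
      intro d
      induction d with
      | zero => intro _; simpa using h0
      | succ d ih =>
        intro hd
        have := (hshift (i₀ - (d + 1)) (by omega)).2
        rw [show i₀ - (d + 1) + 1 = i₀ - d by omega] at this ⊢
        refine this ?_
        rw [show i₀ - (d + 1) + 2 = i₀ - d + 1 by omega]
        exact ih (by omega)
    have hzero : s 0 ^ m = s 1 ^ m := by simpa using hdown i₀ le_rfl
    intro k
    induction k with
    | zero => intro _; exact hzero
    | succ k ih => intro hk; exact (hshift k (by omega)).1 (ih (by omega))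
  have hbase : ∀ k, k < N → s k ^ m = s 0 ^ m := by
    intro k
    induction k with
    | zero => intro _; rfl
    | succ k ih => intro hk; rw [← hall k hk, ih (by omega)]
  rw [hbase i hi, hbase j hj]

end BraidSequence

/-! ### Generators and degree of the braid group -/

namespace BraidGroup

/-- The standard generators of the braid group, indexed by natural numbers. -/
def sigma (n i : ℕ) : BraidGroup n :=
  if h : i < n - 1 then PresentedGroup.of ⟨i, h⟩ else 1

variable {n : ℕ}

theorem sigma_of_lt {i : ℕ} (h : i < n - 1) : sigma n i = PresentedGroup.of ⟨i, h⟩ := dif_pos h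

theorem sigma_braid {i : ℕ} (h : i + 1 < n - 1) :
    sigma n i * sigma n (i + 1) * sigma n i = sigma n (i + 1) * sigma n i * sigma n (i + 1) := by
  rw [sigma_of_lt h, sigma_of_lt (i := i) (by omega), ← mul_inv_eq_one]
  exact PresentedGroup.one_of_mem (rels := {r | Relator n r})
    (Relator.braid ⟨i, by omega⟩ ⟨i + 1, h⟩ rfl)

theorem sigma_commute {i j : ℕ} (h : i + 2 ≤ j) : Commute (sigma n i) (sigma n j) := by
  by_cases hj : j < n - 1
  · rw [sigma_of_lt hj, sigma_of_lt (i := i) (by omega), commute_iff_eq, ← mul_inv_eq_one]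
    exact PresentedGroup.one_of_mem (rels := {r | Relator n r})
      (Relator.comm ⟨i, by omega⟩ ⟨j, hj⟩ h)
  · rw [sigma, sigma, dif_neg hj]
    exact Commute.one_right _

theorem closure_sigma : Subgroup.closure (sigma n '' Set.Iio (n - 1)) = ⊤ := by
  rw [← PresentedGroup.closure_range_of]
  congr 1
  ext x
  constructor
  · rintro ⟨i, hi, rfl⟩
    exact ⟨⟨i, hi⟩, (sigma_of_lt hi).symm⟩
  · rintro ⟨i, rfl⟩
    exact ⟨i, i.2, sigma_of_lt i.2⟩

theorem hom_ext {G : Type*} [Group G] {f g : BraidGroup n →* G}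
    (h : ∀ i, i < n - 1 → f (sigma n i) = g (sigma n i)) : f = g := by
  refine PresentedGroup.ext fun i => ?_
  have := h i i.2
  rwa [sigma_of_lt i.2] at this

/-- The homomorphism given by elements satisfying the braid relations. -/
def lift {G : Type*} [Group G] (s : ℕ → G)
    (hbr : ∀ i, i + 1 < n - 1 → s i * s (i + 1) * s i = s (i + 1) * s i * s (i + 1))
    (hcm : ∀ i j, i + 2 ≤ j → j < n - 1 → Commute (s i) (s j)) : BraidGroup n →* G :=
  PresentedGroup.toGroup (f := fun i : Fin (n - 1) => s i) (by
    rintro r (⟨i, j, h⟩ | ⟨i, j, h⟩)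
    · simp only [map_mul, map_inv, FreeGroup.lift_apply_of, mul_inv_eq_one]
      rw [← h]
      exact hbr i (by omega)
    · simp only [map_mul, map_inv, FreeGroup.lift_apply_of, mul_inv_eq_one]
      exact hcm i j h j.2)

theorem lift_sigma {G : Type*} [Group G] {s : ℕ → G}
    (hbr : ∀ i, i + 1 < n - 1 → s i * s (i + 1) * s i = s (i + 1) * s i * s (i + 1))
    (hcm : ∀ i j, i + 2 ≤ j → j < n - 1 → Commute (s i) (s j)) {i : ℕ} (hi : i < n - 1) :
    lift s hbr hcm (sigma n i) = s i := by
  rw [sigma_of_lt hi, lift, PresentedGroup.toGroup.of]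

/-- The exponent sum of a braid. -/
def deg (n : ℕ) : BraidGroup n →* Multiplicative ℤ :=
  lift (fun _ => Multiplicative.ofAdd 1) (fun _ _ => rfl) fun _ _ _ _ => Commute.refl _

theorem deg_sigma {i : ℕ} (hi : i < n - 1) : deg n (sigma n i) = Multiplicative.ofAdd 1 :=
  lift_sigma _ _ hi

/-- In an abelian group the braid relation identifies adjacent generators, so the abelianization map
factors through the exponent sum. -/
theorem mem_commutator_iff {x : BraidGroup n} :
    x ∈ commutator (BraidGroup n) ↔ deg n x = 1 := by
  constructor
  · intro hx
    exact Abelianization.commutator_subset_ker (deg n) hx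
  · intro hx
    have key : Abelianization.of (G := BraidGroup n) =
        (zpowersHom _ (Abelianization.of (sigma n 0))).comp (deg n) := by
      refine hom_ext fun i hi => ?_
      rw [MonoidHom.comp_apply, deg_sigma hi, zpowersHom_apply, toAdd_ofAdd, zpow_one]
      have := braid_sequence_pow_eq (N := n - 1) (s := fun i => Abelianization.of (sigma n i))
        (fun i hi => by simp only [← map_mul, sigma_braid hi])
        (fun _ _ _ _ => Commute.all _ _) (m := 1) (i₀ := 0)
      by_cases h : 1 < n - 1
      · simpa using this h (Commute.all _ _) i 0 hi (by omega)
      · rw [show i = 0 by omega]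
    rw [← Abelianization.ker_of, MonoidHom.mem_ker, key, MonoidHom.comp_apply, hx, map_one]

theorem mul_sigma_zpow_mem {j : ℕ} (hj : j < n - 1) (x : BraidGroup n) :
    x * sigma n j ^ (-(deg n x).toAdd) ∈ commutator (BraidGroup n) := by
  rw [mem_commutator_iff, map_mul, map_zpow, deg_sigma hj]
  apply Multiplicative.toAdd.injective
  simp

/-! ### The kernel of a homomorphism from the commutator subgroup -/

section Quotient

variable {G : Type*} [Group G] (q : commutator (BraidGroup n) →* G)

/-- The largest subgroup of the kernel that is normal in the braid group. -/
def core : Subgroup (BraidGroup n) :=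
  (q.ker.map (commutator (BraidGroup n)).subtype).normalCore

instance : (core q).Normal := by unfold core; infer_instance

/-- The image of a generator modulo the core of the kernel. -/
def gen (i : ℕ) : BraidGroup n ⧸ core q := QuotientGroup.mk' (core q) (sigma n i)

variable {q}

theorem eq_one_of_mem_core {x : commutator (BraidGroup n)} (hx : (x : BraidGroup n) ∈ core q) :
    q x = 1 := by
  obtain ⟨y, hy, hyx⟩ := Subgroup.normalCore_le _ hx
  rw [← Subtype.ext hyx]
  exact hy

/-- Every braid is an element of B'_n times a power of σ_j. The power fixes `x` under conjugation,
and the other factor preserves ker q. -/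
theorem mem_core_of_commute {x : commutator (BraidGroup n)} (hx : q x = 1) {j : ℕ}
    (hj : j < n - 1) (hc : Commute (x : BraidGroup n) (sigma n j)) :
    (x : BraidGroup n) ∈ core q := by
  intro g
  have hg := mul_sigma_zpow_mem hj g
  refine ⟨⟨_, hg⟩ * x * ⟨_, hg⟩⁻¹, ?_, ?_⟩
  · change q _ = 1
    rw [map_mul, map_mul, hx, map_inv, mul_one, mul_inv_cancel]
  · have hc' := (hc.symm.zpow_left (-(deg n g).toAdd)).eq
    change g * _ * x * (g * _)⁻¹ = _
    rw [mul_assoc g, hc', mul_inv_rev]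
    group

theorem gen_braid {i : ℕ} (h : i + 1 < n - 1) :
    gen q i * gen q (i + 1) * gen q i = gen q (i + 1) * gen q i * gen q (i + 1) := by
  simp only [gen, ← map_mul, sigma_braid h]

theorem gen_commute {i j : ℕ} (h : i + 2 ≤ j) : Commute (gen q i) (gen q j) :=
  (sigma_commute h).map (QuotientGroup.mk' (core q))

theorem gen_pow_eq {m i₀ : ℕ} (hi₀ : i₀ + 1 < n - 1) (h : Commute (gen q i₀ ^ m) (gen q (i₀ + 1)))
    (i j : ℕ) (hi : i < n - 1) (hj : j < n - 1) : gen q i ^ m = gen q j ^ m :=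
  braid_sequence_pow_eq (N := n - 1) (s := gen q) (fun _ h => gen_braid h)
    (fun _ _ h _ => gen_commute h) hi₀ h i j hi hj

/-- All generators then coincide modulo the core, so the quotient map factors through the exponent
sum, which vanishes on B'_n. -/
theorem map_eq_one_of_gen_commute {i₀ : ℕ} (hi₀ : i₀ + 1 < n - 1)
    (h : Commute (gen q i₀) (gen q (i₀ + 1))) (x : commutator (BraidGroup n)) : q x = 1 := by
  refine eq_one_of_mem_core ?_
  have hgen := gen_pow_eq (m := 1) hi₀ (by simpa using h)
  have hmk : QuotientGroup.mk' (core q) = (zpowersHom _ (gen q 0)).comp (deg n) := by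
    refine hom_ext fun i hi => ?_
    rw [MonoidHom.comp_apply, deg_sigma hi, zpowersHom_apply, toAdd_ofAdd, zpow_one]
    simpa [gen] using hgen i 0 hi (by omega)
  rw [← QuotientGroup.ker_mk' (core q), MonoidHom.mem_ker, hmk, MonoidHom.comp_apply,
    mem_commutator_iff.1 x.2, map_one]

variable (q) in
/-- The squares of all generators agree modulo the kernel. -/
def SquaresAgree : Prop := ∀ i j, i < n - 1 → j < n - 1 → gen q i ^ 2 = gen q j ^ 2

theorem squaresAgree_of_commute {i : ℕ} (hi : i + 1 < n - 1)
    (h : Commute (gen q i ^ 2) (gen q (i + 1))) : SquaresAgree q :=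
  gen_pow_eq hi h

/-- Some further generator is adjacent to exactly one of σ_i and σ_{i+2}; it commutes with the
other, hence with the common square. This needs a fourth generator, hence n ≥ 5. -/
theorem squaresAgree_of_eq (hn : 5 ≤ n) {i : ℕ} (hi : i + 2 < n - 1)
    (h : gen q i ^ 2 = gen q (i + 2) ^ 2) : SquaresAgree q := by
  by_cases hi0 : i = 0
  · subst hi0
    refine squaresAgree_of_commute (i := 2) (by omega) ?_
    rw [← h]
    exact (gen_commute (by omega)).pow_left 2
  · obtain ⟨k, rfl⟩ := Nat.exists_eq_succ_of_ne_zero hi0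
    refine squaresAgree_of_commute (i := k) (by omega) ?_
    refine braid_commute_pow_symm (gen_braid (by omega)) ?_
    rw [h]
    exact (gen_commute (i := k) (by omega)).symm.pow_left 2

/-- Braids commuting with a generator, evaluated after correcting the degree. -/
def twist {j : ℕ} (hj : j < n - 1) (q : commutator (BraidGroup n) →* G) :
    Subgroup.centralizer {sigma n j} →* G where
  toFun x := q ⟨_, mul_sigma_zpow_mem hj x⟩
  map_one' := by
    rw [← map_one q]
    congr 1
    apply Subtype.ext
    simp
  map_mul' x y := by
    rw [← map_mul]
    congr 1
    apply Subtype.ext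
    have hy : Commute (sigma n j) y := Subgroup.mem_centralizer_iff.1 y.2 _ rfl
    have hc := (hy.zpow_left (-(deg n (x : BraidGroup n)).toAdd)).eq
    simp only [Subgroup.coe_mul, map_mul, toAdd_mul, neg_add_rev, zpow_add]
    rw [((Commute.refl (sigma n j)).zpow_zpow _ _).eq, mul_assoc (x : BraidGroup n),
      mul_assoc (x : BraidGroup n), ← mul_assoc (sigma n j ^ _) (y : BraidGroup n), hc, mul_assoc]

/-! ### Lifting relations from G to the quotient by the core -/

section Twist

variable {j : ℕ} {hj : j < n - 1}

theorem twist_of_mem {x : Subgroup.centralizer {sigma n j}}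
    (hx : (x : BraidGroup n) ∈ commutator (BraidGroup n)) : twist hj q x = q ⟨x, hx⟩ := by
  change q _ = _
  congr 1
  apply Subtype.ext
  simp [mem_commutator_iff.1 hx]

theorem mk_eq_one_of_twist {x : Subgroup.centralizer {sigma n j}}
    (hx : (x : BraidGroup n) ∈ commutator (BraidGroup n)) (h : twist hj q x = 1) :
    QuotientGroup.mk' (core q) x = 1 := by
  rw [twist_of_mem hx] at h
  have hc : Commute (sigma n j) x := Subgroup.mem_centralizer_iff.1 x.2 _ rfl
  exact (QuotientGroup.eq_one_iff _).2 (mem_core_of_commute h hj hc.symm)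

/-- The commutator of `x` and `y` has degree zero, commutes with σ_j and is killed by `q`, so it
lies in the core. -/
theorem commute_of_twist {x y : Subgroup.centralizer {sigma n j}}
    (h : Commute (twist hj q x) (twist hj q y)) :
    Commute (QuotientGroup.mk' (core q) x) (QuotientGroup.mk' (core q) y) := by
  have h1 : twist hj q ⁅x, y⁆ = 1 := by
    rw [map_commutatorElement, commutatorElement_eq_one_iff_commute]
    exact h
  have h2 := mk_eq_one_of_twist (x := ⁅x, y⁆)
    (Subgroup.commutator_mem_commutator (Subgroup.mem_top _) (Subgroup.mem_top _)) h1
  rw [← commutatorElement_eq_one_iff_commute, ← map_commutatorElement]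
  exact h2

end Twist

/-- The commutator subgroup of a braid group on at least five strands is perfect. -/
theorem map_eq_one_of_comm {A : Type*} [CommGroup A] (hn : 5 ≤ n)
    (f : commutator (BraidGroup n) →* A) (x : commutator (BraidGroup n)) : f x = 1 := by
  refine map_eq_one_of_gen_commute (i₀ := 0) (by omega) ?_ x
  have hmem : ∀ {i j : ℕ}, i < n - 1 → j < n - 1 →
      sigma n i * (sigma n j)⁻¹ ∈ commutator (BraidGroup n) := by
    intro i j hi hj
    rw [mem_commutator_iff, map_mul, map_inv, deg_sigma hi, deg_sigma hj,
      mul_inv_cancel]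
  have hmem' : (sigma n 1)⁻¹ * sigma n 0 ∈ commutator (BraidGroup n) := by
    rw [mem_commutator_iff, map_mul, map_inv, deg_sigma (by omega),
      deg_sigma (by omega), inv_mul_cancel]
  have h03 := (sigma_commute (n := n) (show 0 + 2 ≤ 3 by omega))
  have h13 := (sigma_commute (n := n) (show 1 + 2 ≤ 3 by omega))
  have hb := sigma_braid (n := n) (i := 0) (by omega)
  -- Since σ_3 commutes with σ_0 and σ_1, the element σ_0σ_3⁻¹ of B'_n conjugates σ_1σ_0⁻¹ exactly
  -- as σ_0 does, which exhibits σ_1⁻¹σ_0 as a commutator inside B'_n.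
  have e : (⟨_, hmem'⟩ : commutator (BraidGroup n)) =
      ⁅(⟨_, hmem (i := 0) (j := 3) (by omega) (by omega)⟩ : commutator (BraidGroup n)),
        ⟨_, hmem (i := 1) (j := 0) (by omega) (by omega)⟩⁆ := by
    apply Subtype.ext
    simp only [commutatorElement_def, Subgroup.coe_mul, Subgroup.coe_inv]
    have h3 : Commute (sigma n 3)⁻¹ (sigma n 1 * (sigma n 0)⁻¹) :=
      (h13.symm.mul_right h03.symm.inv_right).inv_left
    have h4 : sigma n 0 * (sigma n 3)⁻¹ * (sigma n 1 * (sigma n 0)⁻¹) *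
        (sigma n 0 * (sigma n 3)⁻¹)⁻¹ = (sigma n 1)⁻¹ * sigma n 0 * sigma n 1 * (sigma n 0)⁻¹ := by
      rw [mul_assoc (sigma n 0), h3.eq, braid_inv_mul_mul hb]
      group
    rw [h4]
    group
  have h1 : f ⟨_, hmem'⟩ = 1 := by
    rw [e, map_commutatorElement, commutatorElement_eq_one_iff_commute]
    exact Commute.all _ _
  have h2 := mem_core_of_commute h1 (j := 3) (by omega)
    (h13.inv_left.mul_left h03)
  have h3 : gen f 1 = gen f 0 := by
    rw [gen, gen, ← inv_mul_eq_one, ← map_inv, ← map_mul]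
    exact (QuotientGroup.eq_one_iff _).2 h2
  exact h3 ▸ Commute.refl _

end Quotient

end BraidGroup

/-! ### The symmetric group as a quotient of the braid group -/

section CoxeterBound

variable {G : Type*} [Group G] {k : ℕ} {s : ℕ → G}

/-- The product `s (k + 1 - j) * ⋯ * s k` of `j` consecutive elements. -/
def descendingProd (s : ℕ → G) (k : ℕ) : ℕ → G
  | 0 => 1
  | j + 1 => s (k - j) * descendingProd s k j

theorem commute_descendingProd (hcm : ∀ i j, i + 2 ≤ j → j ≤ k → Commute (s i) (s j)) {i j : ℕ}
    (h : i + j < k) : Commute (s i) (descendingProd s k j) := by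
  induction j with
  | zero => exact Commute.one_right _
  | succ j ih => exact (hcm i (k - j) (by omega) (by omega)).mul_right (ih (by omega))

theorem mul_descendingProd
    (hbr : ∀ i, i < k → s i * s (i + 1) * s i = s (i + 1) * s i * s (i + 1))
    (hcm : ∀ i j, i + 2 ≤ j → j ≤ k → Commute (s i) (s j)) {i j : ℕ} (hi : i < k) (hj : j ≤ k + 1)
    (h : k < i + j) :
    s (i + 1) * descendingProd s k j = descendingProd s k j * s i := by
  induction j with
  | zero => omega
  | succ j ih =>
    by_cases hij : k < i + j
    · change s (i + 1) * (s (k - j) * descendingProd s k j) = _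
      rw [← mul_assoc, ← (hcm (k - j) (i + 1) (by omega) (by omega)).eq, mul_assoc,
        ih (by omega) hij]
      simp only [descendingProd, mul_assoc]
    · obtain ⟨j, rfl⟩ : ∃ l, j = l + 1 := ⟨j - 1, by omega⟩
      change s (i + 1) * (s (k - (j + 1)) * (s (k - j) * descendingProd s k j)) =
        s (k - (j + 1)) * (s (k - j) * descendingProd s k j) * s i
      rw [show k - (j + 1) = i by omega, show k - j = i + 1 by omega, mul_assoc (s i), mul_assoc,
        ← (commute_descendingProd hcm (i := i) (j := j) (by omega)).eq]
      simp only [← mul_assoc]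
      rw [hbr i hi]

/-- With H generated by the first `k` elements, left multiplication by a generator permutes the `k +
2` sets `descendingProd s k j * H`. Each new generator thus multiplies the bound by at most `k + 2`.
-/
theorem exists_finset_closure_of_coxeter {N : ℕ}
    (hbr : ∀ i, i + 1 < N → s i * s (i + 1) * s i = s (i + 1) * s i * s (i + 1))
    (hcm : ∀ i j, i + 2 ≤ j → j < N → Commute (s i) (s j)) (hsq : ∀ i, i < N → s i * s i = 1)
    (k : ℕ) (hk : k ≤ N) :
    ∃ T : Finset G, T.card ≤ (k + 1)! ∧ ∀ x ∈ Subgroup.closure (s '' Set.Iio k), x ∈ T := by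
  classical
  induction k with
  | zero =>
    refine ⟨{1}, by simp, fun x hx => ?_⟩
    have : (Set.Iio 0 : Set ℕ) = ∅ := by ext; simp
    rw [this, Set.image_empty, Subgroup.closure_empty] at hx
    simpa using hx
  | succ k ih =>
    obtain ⟨T, hT, hmem⟩ := ih (by omega)
    refine ⟨Finset.image₂ (fun j t => descendingProd s k j * t) (Finset.range (k + 2)) T, ?_, ?_⟩
    · refine (Finset.card_image₂_le _ _ _).trans ?_
      rw [Finset.card_range, Nat.factorial_succ (k + 1)]
      exact Nat.mul_le_mul_left _ hT
    · have hcm' : ∀ i j, i + 2 ≤ j → j ≤ k → Commute (s i) (s j) :=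
        fun i j hij hj => hcm i j hij (by omega)
      have hgen : ∀ i, i < k → s i ∈ Subgroup.closure (s '' Set.Iio k) :=
        fun i hi => Subgroup.subset_closure ⟨i, hi, rfl⟩
      have step : ∀ i, i ≤ k → ∀ x, (∃ j, j < k + 2 ∧ ∃ h ∈ Subgroup.closure (s '' Set.Iio k),
          descendingProd s k j * h = x) →
          ∃ j, j < k + 2 ∧ ∃ h ∈ Subgroup.closure (s '' Set.Iio k),
            descendingProd s k j * h = s i * x := by
        rintro i hi _ ⟨j, hj, h, hh, rfl⟩
        obtain hlt | heq | heq | hgt : i + j < k ∨ i + j = k ∨ i + j = k + 1 ∨ k + 1 < i + j := by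
          omega
        · refine ⟨j, hj, s i * h, Subgroup.mul_mem _ (hgen i (by omega)) hh, ?_⟩
          rw [← mul_assoc, ← mul_assoc, (commute_descendingProd hcm' hlt).eq]
        · refine ⟨j + 1, by omega, h, hh, ?_⟩
          rw [descendingProd, show k - j = i by omega, mul_assoc]
        · obtain rfl | ⟨l, rfl⟩ : j = 0 ∨ ∃ l, j = l + 1 := by
            cases j with
            | zero => exact Or.inl rfl
            | succ l => exact Or.inr ⟨l, rfl⟩
          · omega
          · refine ⟨l, by omega, h, hh, ?_⟩
            rw [descendingProd, show k - l = i by omega, ← mul_assoc, ← mul_assoc,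
              hsq i (by omega), one_mul]
        · obtain ⟨l, rfl⟩ : ∃ l, i = l + 1 := ⟨i - 1, by omega⟩
          refine ⟨j, hj, s l * h, Subgroup.mul_mem _ (hgen l (by omega)) hh, ?_⟩
          rw [← mul_assoc, ← mul_assoc,
            mul_descendingProd (fun i hi => hbr i (by omega)) hcm' (by omega) (by omega) (by omega)]
      intro x hx
      have : ∃ j, j < k + 2 ∧ ∃ h ∈ Subgroup.closure (s '' Set.Iio k),
          descendingProd s k j * h = x := by
        induction hx using Subgroup.closure_induction_left with
        | one => exact ⟨0, by omega, 1, Subgroup.one_mem _, by simp [descendingProd]⟩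
        | mul_left y hy z _ ih =>
          obtain ⟨i, hi, rfl⟩ := hy
          exact step i (Nat.lt_succ_iff.1 hi) z ih
        | inv_mul_cancel y hy z _ ih =>
          obtain ⟨i, hi, rfl⟩ := hy
          have hi' : i < k + 1 := hi
          rw [inv_eq_of_mul_eq_one_left (hsq i (by omega))]
          exact step i (by omega) z ih
      obtain ⟨j, hj, h, hh, rfl⟩ := this
      exact Finset.mem_image₂_of_mem (Finset.mem_range.2 hj) (hmem h hh)

end CoxeterBound

namespace BraidGroup

variable {n : ℕ}

theorem toPerm_sigma {i : ℕ} (hi : i < n - 1) :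
    toPerm n (sigma n i) = adjSwap n ⟨i, hi⟩ := by
  rw [sigma_of_lt hi, toPerm, PresentedGroup.toGroup.of]

theorem toPerm_surjective (hn : 1 ≤ n) : Function.Surjective (toPerm n) := by
  obtain ⟨m, rfl⟩ : ∃ m, n = m + 1 := ⟨n - 1, by omega⟩
  rw [← MonoidHom.range_eq_top, eq_top_iff]
  intro x _
  have hx : x ∈ Submonoid.closure
      (Set.range fun i : Fin m => Equiv.swap i.castSucc i.succ) := by
    rw [Equiv.Perm.mclosure_swap_castSucc_succ]; trivial
  have hle : Submonoid.closure (Set.range fun i : Fin m => Equiv.swap i.castSucc i.succ) ≤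
      (toPerm (m + 1)).range.toSubmonoid := by
    rw [Submonoid.closure_le]
    rintro _ ⟨i, rfl⟩
    refine ⟨sigma (m + 1) i, ?_⟩
    rw [toPerm_sigma (by simp)]
    rfl
  exact hle hx

theorem toAlternating_surjective (hn : 5 ≤ n) : Function.Surjective (toAlternating n) := by
  intro x
  have hx : (x : Equiv.Perm (Fin n)) ∈ (commutator (BraidGroup n)).map (toPerm n) := by
    have h1 : alternatingGroup (Fin n) = commutator (Equiv.Perm (Fin n)) :=
      (alternatingGroup.commutator_perm_eq (by simpa using hn)).symm
    rw [commutator_def, Subgroup.map_commutator,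
      ← MonoidHom.range_eq_map, MonoidHom.range_eq_top.2 (toPerm_surjective (by omega)),
      ← commutator_def, ← h1]
    exact x.2
  obtain ⟨y, hy, hyx⟩ := hx
  exact ⟨⟨y, hy⟩, Subtype.ext hyx⟩

/-- Modulo the normal closure the generators satisfy the Coxeter relations, so the quotient has at
most n! elements. It maps onto the symmetric group, hence isomorphically. -/
theorem mem_normalClosure_of_toPerm_eq_one (hn : 2 ≤ n) {x : BraidGroup n} (hx : toPerm n x = 1) :
    x ∈ Subgroup.normalClosure {sigma n 0 ^ 2} := by
  obtain ⟨M, hM⟩ : ∃ M, M = Subgroup.normalClosure {sigma n 0 ^ 2} := ⟨_, rfl⟩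
  have hMn : M.Normal := hM ▸ Subgroup.normalClosure_normal
  rw [← hM]
  obtain ⟨p, hp⟩ : ∃ p : BraidGroup n →* BraidGroup n ⧸ M, p = QuotientGroup.mk' M := ⟨_, rfl⟩
  have hsurj : Function.Surjective p := hp ▸ QuotientGroup.mk'_surjective M
  have h0 : p (sigma n 0) ^ 2 = 1 := by
    rw [← map_pow, hp]
    refine (QuotientGroup.eq_one_iff _).2 ?_
    rw [hM]
    exact Subgroup.subset_normalClosure rfl
  have hbr : ∀ i, i + 1 < n - 1 → p (sigma n i) * p (sigma n (i + 1)) * p (sigma n i) =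
      p (sigma n (i + 1)) * p (sigma n i) * p (sigma n (i + 1)) :=
    fun i hi => by simp only [← map_mul, sigma_braid hi]
  have hcm : ∀ i j, i + 2 ≤ j → j < n - 1 → Commute (p (sigma n i)) (p (sigma n j)) :=
    fun i j hij _ => (sigma_commute hij).map p
  have hsq : ∀ i, i < n - 1 → p (sigma n i) * p (sigma n i) = 1 := by
    intro i hi
    rw [← pow_two]
    by_cases h : 1 < n - 1
    · rw [braid_sequence_pow_eq (s := fun i => p (sigma n i)) hbr hcm (i₀ := 0) (m := 2) h
        (by rw [h0]; exact Commute.one_left _) i 0 hi (by omega), h0]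
    · rw [show i = 0 by omega, h0]
  obtain ⟨T, hT, hmem⟩ := exists_finset_closure_of_coxeter (s := fun i => p (sigma n i)) hbr hcm hsq
    (n - 1) le_rfl
  have htop : Subgroup.closure ((fun i => p (sigma n i)) '' Set.Iio (n - 1)) = ⊤ := by
    rw [← Set.image_image, ← MonoidHom.map_closure, closure_sigma, ← MonoidHom.range_eq_map,
      MonoidHom.range_eq_top.2 hsurj]
  have hfin : Finite (BraidGroup n ⧸ M) :=
    Set.finite_univ_iff.1 (T.finite_toSet.subset fun y _ => hmem y (htop ▸ Subgroup.mem_top y))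
  have hcard : Nat.card (BraidGroup n ⧸ M) ≤ n ! := by
    rw [Nat.sub_add_cancel (by omega)] at hT
    refine le_trans ?_ hT
    rw [← Nat.card_eq_fintype_card.trans (Fintype.card_coe T)]
    exact Nat.card_le_card_of_injective
      (fun y => (⟨y, hmem y (htop ▸ Subgroup.mem_top y)⟩ : T)) fun y z h => congrArg Subtype.val h
  have hMle : M ≤ (toPerm n).ker := by
    rw [hM]
    refine Subgroup.normalClosure_le_normal ?_
    rintro _ rfl
    rw [SetLike.mem_coe, MonoidHom.mem_ker, map_pow, toPerm_sigma (by omega), pow_two, adjSwap,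
      Equiv.swap_mul_self]
  obtain ⟨f, hf⟩ : ∃ f : BraidGroup n ⧸ M →* Equiv.Perm (Fin n), ∀ y, f (p y) = toPerm n y :=
    ⟨QuotientGroup.lift M (toPerm n) hMle, fun y => by rw [hp]; rfl⟩
  have hfs : Function.Surjective f := by
    intro y
    obtain ⟨z, rfl⟩ := toPerm_surjective (by omega : 1 ≤ n) y
    exact ⟨_, hf z⟩
  have hfb : Function.Bijective f := by
    refine hfs.bijective_of_nat_card_le ?_
    rwa [Nat.card_perm, Nat.card_fin]
  have hx1 : p x = 1 := hfb.1 (by rw [hf, hx, map_one])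
  rw [hp] at hx1
  exact (QuotientGroup.eq_one_iff _).1 hx1

theorem toAlternating_ker_le {G : Type*} [Group G] {q : commutator (BraidGroup n) →* G}
    (hn : 2 ≤ n) (h : SquaresAgree q) : (toAlternating n).ker ≤ q.ker := by
  intro x hx
  have hx' : toPerm n x = 1 := congrArg Subtype.val (MonoidHom.mem_ker.1 hx)
  obtain ⟨p, hp⟩ : ∃ p : BraidGroup n →* BraidGroup n ⧸ core q, p = QuotientGroup.mk' (core q) :=
    ⟨_, rfl⟩
  have hgen : ∀ i, p (sigma n i) = gen q i := fun i => by rw [hp, gen]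
  have hcentral : ∀ y, Commute (gen q 0 ^ 2) (p y) := by
    intro y
    have hy : y ∈ Subgroup.closure (sigma n '' Set.Iio (n - 1)) := by
      rw [closure_sigma]; trivial
    induction hy using Subgroup.closure_induction with
    | mem y hy =>
      obtain ⟨i, hi, rfl⟩ := hy
      rw [h 0 i (by omega) hi, hgen]
      exact Commute.pow_self _ 2
    | one => rw [map_one]; exact Commute.one_right _
    | mul a b _ _ ha hb => rw [map_mul]; exact ha.mul_right hb
    | inv a _ ha => rw [map_inv]; exact ha.inv_right
  have hle : Subgroup.normalClosure {sigma n 0 ^ 2} ≤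
      (Subgroup.zpowers (gen q 0 ^ 2)).comap p := by
    have hnorm : ((Subgroup.zpowers (gen q 0 ^ 2)).comap p).Normal := by
      refine ⟨fun a ha g => ?_⟩
      obtain ⟨k, hk⟩ := ha
      have hk' : (gen q 0 ^ 2) ^ k = p a := hk
      rw [Subgroup.mem_comap, map_mul, map_mul, ← hk', map_inv,
        ← ((hcentral g).zpow_left k).eq, mul_inv_cancel_right]
      exact ⟨k, rfl⟩
    refine Subgroup.normalClosure_le_normal ?_
    rintro _ rfl
    rw [SetLike.mem_coe, Subgroup.mem_comap, map_pow, hgen]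
    exact Subgroup.mem_zpowers _
  obtain ⟨k, hk⟩ := hle (mem_normalClosure_of_toPerm_eq_one hn hx')
  have hk' : (gen q 0 ^ 2) ^ k = p x := hk
  have hcore : (sigma n 0 ^ 2) ^ (-k) * (x : BraidGroup n) ∈ core q := by
    refine (QuotientGroup.eq_one_iff _).1 ?_
    change QuotientGroup.mk' (core q) _ = 1
    rw [← hp, map_mul, ← hk', map_zpow, map_pow, hgen, ← zpow_add, neg_add_cancel, zpow_zero]
  -- The core lies in B'_n, so its elements have degree zero; this degree is -2k, which forces k =
  -- 0.
  have hdeg : deg n ((sigma n 0 ^ 2) ^ (-k) * (x : BraidGroup n)) = 1 := by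
    rw [← mem_commutator_iff]
    obtain ⟨y, -, hy⟩ := Subgroup.normalCore_le _ hcore
    rw [← hy]
    exact y.2
  have hk0 : k = 0 := by
    rw [map_mul, mem_commutator_iff.1 x.2, mul_one, map_zpow, map_pow, deg_sigma (by omega)] at hdeg
    have := congrArg Multiplicative.toAdd hdeg
    simpa using this
  subst hk0
  refine MonoidHom.mem_ker.2 (eq_one_of_mem_core ?_)
  simpa using hcore

theorem exists_mulEquiv_of_squaresAgree {G : Type*} [Group G] [Nontrivial G]
    {q : commutator (BraidGroup n) →* G} (hn : 5 ≤ n) (hq : Function.Surjective q)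
    (h : SquaresAgree q) :
    ∃ e : alternatingGroup (Fin n) ≃* G, ∀ x, e (toAlternating n x) = q x := by
  have hs := toAlternating_surjective hn
  obtain ⟨f, hf⟩ : ∃ f : alternatingGroup (Fin n) →* G, f.comp (toAlternating n) = q :=
    ⟨_, MonoidHom.liftOfRightInverse_comp _ _ (Function.rightInverse_surjInv hs)
      ⟨q, toAlternating_ker_le (by omega) h⟩⟩
  have hfx : ∀ x, f (toAlternating n x) = q x := fun x => DFunLike.congr_fun hf x
  have hfs : Function.Surjective f := by
    intro g
    obtain ⟨x, rfl⟩ := hq g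
    exact ⟨_, hfx x⟩
  have := alternatingGroup.isSimpleGroup (α := Fin n) (by simpa using hn)
  have hfi : Function.Injective f := by
    rw [← MonoidHom.ker_eq_bot_iff]
    refine (IsSimpleGroup.eq_bot_or_eq_top_of_normal f.ker inferInstance).resolve_right fun ht => ?_
    obtain ⟨g, hg⟩ := exists_ne (1 : G)
    obtain ⟨y, rfl⟩ := hfs g
    exact hg (MonoidHom.mem_ker.1 (ht ▸ Subgroup.mem_top y))
  exact ⟨MulEquiv.ofBijective f ⟨hfi, hfs⟩, hfx⟩

theorem nat_card_of_squaresAgree {G : Type*} [Group G] [Nontrivial G]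
    {q : commutator (BraidGroup n) →* G} (hn : 5 ≤ n) (hq : Function.Surjective q)
    (h : SquaresAgree q) : Nat.card G = n ! / 2 := by
  obtain ⟨e, -⟩ := exists_mulEquiv_of_squaresAgree hn hq h
  have : Nontrivial (Fin n) := Fin.nontrivial_iff_two_le.2 (by omega)
  rw [← Nat.card_congr e.toEquiv, nat_card_alternatingGroup, Nat.card_fin]

end BraidGroup

/-! ### Growth of the subgroups generated by braid sequences -/

section Growth

variable {G : Type*} [Group G]

theorem mul_inv_mem_commutator_of_braid {P : Subgroup G} {a b : G} (h : a * b * a = b * a * b)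
    (ha : a ∈ P) (hb : b ∈ P) : b * a⁻¹ ∈ ⁅P, P⁆ := by
  have : b * a⁻¹ = ⁅a * b, a⁆ := by rw [commutatorElement_def, braid_conj h]
  rw [this]
  exact Subgroup.commutator_mem_commutator (P.mul_mem ha hb) ha

theorem card_closure_ge_of_braid [Finite G] {P : Subgroup G} {a b : G} (h : a * b * a = b * a * b)
    (ha : a ∈ P) (hb : b ∈ P) (h2 : ¬ Commute (a ^ 2) b)
    (huv : ¬ Commute (b * a⁻¹) (a * (b * a⁻¹) * a⁻¹)) : 21 ≤ Nat.card P := by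
  refine card_ge_of_braid (a := (⟨a, ha⟩ : P)) (b := ⟨b, hb⟩) (Subtype.ext h)
    (fun hc => h2 (hc.map P.subtype)) fun hc => huv (hc.map P.subtype)

/-- The start is 5! = 120 < 6 · 21, and the generator that enlarges m = k + 2 to m + 1 multiplies
the order by at least k + 6 = m + 4. -/
theorem factorial_lt_card_closure [Finite G] {N : ℕ} {s : ℕ → G}
    (hbr : ∀ i, i + 1 < N → s i * s (i + 1) * s i = s (i + 1) * s i * s (i + 1))
    (hcm : ∀ i j, i + 2 ≤ j → j < N → Commute (s i) (s j))
    (hsq : ∀ i, i + 1 < N → ¬ Commute (s i ^ 2) (s (i + 1)))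
    (huv : ¬ Commute (s 1 * (s 0)⁻¹) (s 0 * (s 1 * (s 0)⁻¹) * (s 0)⁻¹)) {m : ℕ} (hm : 2 ≤ m)
    (hmN : m < N) : (m + 3)! < 6 * Nat.card (Subgroup.closure (s '' Set.Iio m)) := by
  induction m, hm using Nat.le_induction with
  | base =>
    have := card_closure_ge_of_braid (P := Subgroup.closure (s '' Set.Iio 2)) (hbr 0 (by omega))
      (Subgroup.subset_closure ⟨0, by simp, rfl⟩) (Subgroup.subset_closure ⟨1, by simp, rfl⟩)
      (hsq 0 (by omega)) huv
    have h5 : (2 + 3)! = 120 := rfl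
    omega
  | succ m hm ih =>
    obtain ⟨k, rfl⟩ : ∃ k, m = k + 2 := ⟨m - 2, by omega⟩
    have ih := ih (by omega)
    obtain ⟨L, hL⟩ : ∃ L, L = Subgroup.closure (s '' Set.Iio (k + 2)) := ⟨_, rfl⟩
    -- One spare generator is needed here: `s (k + 3)` centralizes `L` but not `s (k + 2) ^ 2`.
    have hsqL : s (k + 2) ^ 2 ∉ L := by
      intro hmem
      have hle : L ≤ Subgroup.centralizer {s (k + 2 + 1)} := by
        rw [hL, Subgroup.closure_le]
        rintro _ ⟨i, hi, rfl⟩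
        have hi' : i < k + 2 := hi
        rw [SetLike.mem_coe, Subgroup.mem_centralizer_singleton_iff]
        exact (hcm i (k + 2 + 1) (by omega) hmN).eq
      have := Subgroup.mem_centralizer_singleton_iff.1 (hle hmem)
      exact hsq (k + 2) hmN this
    obtain ⟨ι, hι, f, hcard, hf, hd⟩ := exists_braid_transversal k s
      (fun i hi => hbr i (by omega)) (fun i j hij hj => hcm i j hij (by omega)) L
      (fun i hi => hL ▸ Subgroup.subset_closure ⟨i, hi, rfl⟩) hsqL
    have hset : (Set.Iic (k + 2) : Set ℕ) = Set.Iio (k + 2 + 1) := by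
      ext; simp
    rw [hset] at hf
    have hle : L ≤ Subgroup.closure (s '' Set.Iio (k + 2 + 1)) := by
      rw [hL]
      exact Subgroup.closure_mono (Set.image_mono (Set.Iio_subset_Iio (by omega)))
    have h1 := card_mul_card_le_of_transversal hle f hf hd
    rw [hcard] at h1
    rw [← hL] at ih
    rw [show k + 2 + 1 + 3 = (k + 2 + 3) + 1 by omega, Nat.factorial_succ]
    calc (k + 2 + 3 + 1) * (k + 2 + 3)! < (k + 2 + 3 + 1) * (6 * Nat.card L) :=
          Nat.mul_lt_mul_of_pos_left ih (by omega)
      _ = 6 * ((k + 6) * Nat.card L) := by ring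
      _ ≤ _ := Nat.mul_le_mul_left _ h1

end Growth

namespace BraidGroup

variable {n : ℕ}

/-! ### Twisted generators -/

theorem sigma_div_mem {i j : ℕ} (hi : i < n - 1) (hj : j < n - 1) :
    sigma n i * (sigma n j)⁻¹ ∈ commutator (BraidGroup n) := by
  rw [mem_commutator_iff, map_mul, map_inv, deg_sigma hi, deg_sigma hj, mul_inv_cancel]

/-- A generator as an element of the centralizer of a generator it commutes with. -/
def centralSigma (n j i : ℕ) : Subgroup.centralizer {sigma n j} :=
  if h : i + 2 ≤ j ∨ j + 2 ≤ i then
    ⟨sigma n i, Subgroup.mem_centralizer_singleton_iff.2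
      (h.elim (fun h => (sigma_commute h).eq) fun h => (sigma_commute h).eq.symm)⟩
  else 1

theorem coe_centralSigma {i j : ℕ} (h : i + 2 ≤ j ∨ j + 2 ≤ i) :
    (centralSigma n j i : BraidGroup n) = sigma n i := by
  rw [centralSigma, dif_pos h]

theorem map_eq_one_of_div {A : Type*} [Group A] (hn : 5 ≤ n) {f : commutator (BraidGroup n) →* A}
    (h : f ⟨_, sigma_div_mem (i := 1) (j := 0) (by omega) (by omega)⟩ = 1)
    (x : commutator (BraidGroup n)) : f x = 1 := by
  refine map_eq_one_of_gen_commute (i₀ := 0) (by omega) ?_ x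
  have h2 := mem_core_of_commute h (j := 3) (by omega)
    ((sigma_commute (by omega)).mul_left (sigma_commute (by omega)).inv_left)
  have h3 : gen f 1 = gen f 0 := by
    rw [gen, gen, ← mul_inv_eq_one, ← map_inv, ← map_mul]
    exact (QuotientGroup.eq_one_iff _).2 h2
  exact h3 ▸ Commute.refl _

section Twisted

variable {G : Type*} [Group G] {q : commutator (BraidGroup n) →* G} {j : ℕ} {hj : j < n - 1}

theorem twist_centralSigma {i : ℕ} (hi : i < n - 1) (h : i + 2 ≤ j ∨ j + 2 ≤ i) :
    twist hj q (centralSigma n j i) = q ⟨_, sigma_div_mem hi hj⟩ := by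
  change q _ = _
  congr 1
  apply Subtype.ext
  simp [coe_centralSigma h, deg_sigma hi]

theorem twist_braid {i : ℕ} (hi : i + 1 < n - 1) (h : i + 2 ≤ j ∨ j + 2 ≤ i)
    (h' : i + 1 + 2 ≤ j ∨ j + 2 ≤ i + 1) :
    twist hj q (centralSigma n j i) * twist hj q (centralSigma n j (i + 1)) *
        twist hj q (centralSigma n j i) =
      twist hj q (centralSigma n j (i + 1)) * twist hj q (centralSigma n j i) *
        twist hj q (centralSigma n j (i + 1)) := by
  simp only [← map_mul]
  congr 1
  apply Subtype.ext
  simp only [Subgroup.coe_mul, coe_centralSigma h, coe_centralSigma h', sigma_braid hi]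

theorem twist_commute {i k : ℕ} (hik : i + 2 ≤ k) :
    Commute (twist hj q (centralSigma n j i)) (twist hj q (centralSigma n j k)) := by
  refine Commute.map (Subtype.ext ?_) _
  by_cases h : i + 2 ≤ j ∨ j + 2 ≤ i
  · by_cases h' : k + 2 ≤ j ∨ j + 2 ≤ k
    · simp only [Subgroup.coe_mul, coe_centralSigma h, coe_centralSigma h', (sigma_commute hik).eq]
    · simp [centralSigma, h']
  · simp [centralSigma, h]

theorem not_commute_twist_sq (hs : ¬ SquaresAgree q) {i : ℕ} (hi : i + 1 < n - 1)
    (h : i + 2 ≤ j ∨ j + 2 ≤ i) (h' : i + 1 + 2 ≤ j ∨ j + 2 ≤ i + 1) :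
    ¬ Commute (twist hj q (centralSigma n j i) ^ 2) (twist hj q (centralSigma n j (i + 1))) := by
  intro hc
  rw [← map_pow] at hc
  have := commute_of_twist hc
  rw [Subgroup.coe_pow, coe_centralSigma h, coe_centralSigma h', map_pow] at this
  exact hs (squaresAgree_of_commute hi this)

theorem not_commute_twist_div (hn : 5 ≤ n) (hs : ¬ SquaresAgree q) {i : ℕ} (hi : i + 2 < n - 1)
    (h : i + 2 ≤ j ∨ j + 2 ≤ i) (h' : i + 1 + 2 ≤ j ∨ j + 2 ≤ i + 1) {a b : G}
    (ha : a = twist hj q (centralSigma n j i)) (hb : b = twist hj q (centralSigma n j (i + 1))) :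
    ¬ Commute (b * a⁻¹) (a * (b * a⁻¹) * a⁻¹) := by
  intro hc
  rw [ha, hb] at hc
  simp only [← map_inv, ← map_mul] at hc
  have := commute_of_twist hc
  simp only [Subgroup.coe_mul, Subgroup.coe_inv, coe_centralSigma h, coe_centralSigma h', map_mul,
    map_inv] at this
  exact hs (squaresAgree_of_eq hn hi
    (braid_sq_eq_of_commute (gen_braid (by omega)) (gen_braid hi) (gen_commute le_rfl) this))

theorem card_ge_of_not_squaresAgree [Finite G] (hn : 5 ≤ n) (hs : ¬ SquaresAgree q) {i : ℕ}
    (hi : i + 2 < n - 1) (h : i + 2 ≤ j ∨ j + 2 ≤ i) (h' : i + 1 + 2 ≤ j ∨ j + 2 ≤ i + 1)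
    {P : Subgroup G} (ha : twist hj q (centralSigma n j i) ∈ P)
    (hb : twist hj q (centralSigma n j (i + 1)) ∈ P) : 21 ≤ Nat.card P :=
  card_closure_ge_of_braid (twist_braid (by omega) h h') ha hb
    (not_commute_twist_sq hs (by omega) h h') (not_commute_twist_div hn hs hi h h' rfl rfl)

theorem commute_mk_of_commute {x y : commutator (BraidGroup n)} (h : Commute (q x) (q y))
    (hj : j < n - 1) (hx : Commute (x : BraidGroup n) (sigma n j))
    (hy : Commute (y : BraidGroup n) (sigma n j)) :
    Commute (QuotientGroup.mk' (core q) x) (QuotientGroup.mk' (core q) y) := by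
  have h1 : q ⁅x, y⁆ = 1 := by
    rw [map_commutatorElement, commutatorElement_eq_one_iff_commute]
    exact h
  have h2 : Commute ((⁅x, y⁆ : commutator (BraidGroup n)) : BraidGroup n) (sigma n j) := by
    simp only [commutatorElement_def, Subgroup.coe_mul, Subgroup.coe_inv]
    exact ((hx.mul_left hy).mul_left hx.inv_left).mul_left hy.inv_left
  rw [← commutatorElement_eq_one_iff_commute, ← map_commutatorElement]
  exact (QuotientGroup.eq_one_iff _).2 (mem_core_of_commute h1 hj h2)

/-- On commutators the degree correction disappears, so `x` has to commute with `W` only and not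
with σ_j. -/
theorem commute_of_mem_commutator_map {W : Subgroup (Subgroup.centralizer {sigma n j})} {g : G}
    (hg : g ∈ ⁅W.map (twist hj q), W.map (twist hj q)⁆) {x : commutator (BraidGroup n)}
    (hx : ∀ w ∈ W, Commute (w : BraidGroup n) x) : Commute g (q x) := by
  rw [← Subgroup.map_commutator] at hg
  obtain ⟨w, hw, rfl⟩ := hg
  have hwc : (w : BraidGroup n) ∈ commutator (BraidGroup n) := by
    have : w ∈ commutator (Subgroup.centralizer {sigma n j}) :=
      Subgroup.commutator_mono le_top le_top hw
    have h2 := Subgroup.mem_map_of_mem (Subgroup.centralizer {sigma n j}).subtype this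
    rw [commutator_def, Subgroup.map_commutator] at h2
    exact Subgroup.commutator_mono le_top le_top h2
  rw [twist_of_mem hwc]
  have hc := hx w (Subgroup.commutator_le_self W hw)
  exact Commute.map (Subtype.ext hc.eq : Commute (⟨w, hwc⟩ : commutator (BraidGroup n)) x) q

end Twisted

end BraidGroup

namespace BraidGroup

variable {n : ℕ}

/-! ### A large proper subgroup of a quotient -/

section Normalizer

variable {G : Type*} [Group G] {q : commutator (BraidGroup n) →* G}

theorem commute_of_mem_commutator_closure {j m : ℕ} {hj : j < n - 1} (hm : m + 1 ≤ j) {g : G}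
    (hg : g ∈ ⁅Subgroup.closure ((fun i => twist hj q (centralSigma n j i)) '' Set.Iio m),
      Subgroup.closure ((fun i => twist hj q (centralSigma n j i)) '' Set.Iio m)⁆)
    {x : commutator (BraidGroup n)} (hx : ∀ i < m, Commute (sigma n i) (x : BraidGroup n)) :
    Commute g (q x) := by
  rw [← Set.image_image (twist hj q), ← MonoidHom.map_closure] at hg
  refine commute_of_mem_commutator_map hg fun w hw => ?_
  induction hw using Subgroup.closure_induction with
  | mem y hy =>
    obtain ⟨i, hi, rfl⟩ := hy
    have hi' : i < m := hi
    rw [coe_centralSigma (by omega)]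
    exact hx i hi
  | one => exact Commute.one_left _
  | mul a b _ _ ha hb => exact ha.mul_left hb
  | inv a _ ha => exact ha.inv_left

/-- Put u = σ_{n-3}σ_{n-2}⁻¹. Its conjugate by σ_{n-2} commutes with the generators behind `P`, so
its image commutes with [P, P], and in particular with q(u). This lifts modulo the core because both
braids commute with σ_0, and `braid_sq_eq_of_commute` applies. -/
theorem squaresAgree_of_mem_commutator (hn : 6 ≤ n) {P : Subgroup G}
    (hP : P = Subgroup.closure ((fun i => twist (j := n - 2) (by omega) q
      (centralSigma n (n - 2) i)) '' Set.Iio (n - 4)))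
    (h : q ⟨_, sigma_div_mem (i := n - 3) (j := n - 2) (by omega) (by omega)⟩ ∈ ⁅P, P⁆) :
    SquaresAgree q := by
  rw [hP] at h
  have hu := sigma_div_mem (n := n) (i := n - 3) (j := n - 2) (by omega) (by omega)
  have hv : sigma n (n - 2) * (sigma n (n - 3) * (sigma n (n - 2))⁻¹) * (sigma n (n - 2))⁻¹ ∈
      commutator (BraidGroup n) :=
    Subgroup.Normal.conj_mem inferInstance _ hu _
  have hc2 : ∀ i, i < n - 4 → Commute (sigma n i) (sigma n (n - 2)) :=
    fun i hi => sigma_commute (by omega)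
  have hc3 : ∀ i, i < n - 4 → Commute (sigma n i)
      (sigma n (n - 3) * (sigma n (n - 2))⁻¹) :=
    fun i hi => (sigma_commute (by omega)).mul_right (hc2 i hi).inv_right
  have hc4 : ∀ i, i < n - 4 → Commute (sigma n i)
      (sigma n (n - 2) * (sigma n (n - 3) * (sigma n (n - 2))⁻¹) * (sigma n (n - 2))⁻¹) :=
    fun i hi => ((hc2 i hi).mul_right (hc3 i hi)).mul_right (hc2 i hi).inv_right
  have hc := commute_of_mem_commutator_closure (by omega) h (x := ⟨_, hv⟩) hc4
  have hmk := commute_mk_of_commute hc (j := 0) (by omega) (hc3 0 (by omega)).symm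
    (hc4 0 (by omega)).symm
  simp only [map_mul, map_inv] at hmk
  have hb1 := gen_braid (q := q) (i := n - 3) (by omega)
  have hb2 := gen_braid (q := q) (i := n - 4) (by omega)
  rw [show n - 3 + 1 = n - 2 by omega] at hb1
  rw [show n - 4 + 1 = n - 3 by omega] at hb2
  have hsq := braid_sq_eq_of_commute hb1.symm hb2.symm (gen_commute (by omega)).symm hmk
  refine squaresAgree_of_eq (i := n - 4) (by omega) (by omega) ?_
  rw [← hsq, show n - 4 + 2 = n - 2 by omega]

/-- The normalizer of [P, P] contains `P` and also q(σ_{n-3}σ_{n-2}⁻¹), which centralizes [P, P]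
without lying in it. This enlarges `P` at least threefold. -/
theorem exists_proper_subgroup [Finite G] (hn : 6 ≤ n)
    (hs : ¬ SquaresAgree q) :
    ∃ X : Subgroup G, X ≠ ⊤ ∧ (n - 1)! < 2 * Nat.card X := by
  have hj : n - 2 < n - 1 := by omega
  obtain ⟨s, hsd⟩ : ∃ s : ℕ → G, s = fun i => twist hj q (centralSigma n (n - 2) i) := ⟨_, rfl⟩
  obtain ⟨P, hP⟩ : ∃ P, P = Subgroup.closure (s '' Set.Iio (n - 4)) := ⟨_, rfl⟩
  have hmem : ∀ i, i < n - 4 → s i ∈ P := fun i hi => hP ▸ Subgroup.subset_closure ⟨i, hi, rfl⟩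
  have hcard : (n - 1)! < 6 * Nat.card P := by
    have := factorial_lt_card_closure (N := n - 3) (s := s) (m := n - 4)
      (fun i hi => by rw [hsd]; exact twist_braid (by omega) (by omega) (by omega))
      (fun i k hik _ => by rw [hsd]; exact twist_commute hik)
      (fun i hi => by
        rw [hsd]; exact not_commute_twist_sq hs (by omega) (by omega) (by omega))
      (by
        rw [hsd]
        exact not_commute_twist_div (by omega) hs (i := 0) (by omega) (by omega) (by omega) rfl rfl)
      (by omega) (by omega)
    rwa [← hP, show n - 4 + 3 = n - 1 by omega] at this
  have hu : q ⟨_, sigma_div_mem (i := n - 3) (j := n - 2) (by omega) (by omega)⟩ ∉ ⁅P, P⁆ :=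
    fun h => hs (squaresAgree_of_mem_commutator hn (by rw [hP, hsd]) h)
  have hub : q ⟨_, sigma_div_mem (i := n - 3) (j := n - 2) (by omega) (by omega)⟩ =
      twist (j := 0) (by omega) q (centralSigma n 0 (n - 3)) *
        (twist (j := 0) (by omega) q (centralSigma n 0 (n - 3 + 1)))⁻¹ := by
    rw [twist_centralSigma (by omega) (by omega), twist_centralSigma (by omega) (by omega),
      ← map_inv, ← map_mul]
    congr 1
    apply Subtype.ext
    simp [show n - 3 + 1 = n - 2 by omega]
  -- Up to inversion, q(σ_0σ_{n-2}⁻¹) is a twisted generator both for j = n-2 and for j = 0. It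
  -- links `P` to the braid pair `a`, `b` taken at j = 0.
  have ha : s 0 = (twist (j := 0) (by omega) q (centralSigma n 0 (n - 3 + 1)))⁻¹ := by
    rw [hsd]
    change twist hj q _ = _
    rw [twist_centralSigma (by omega) (by omega), twist_centralSigma (by omega) (by omega),
      ← map_inv]
    congr 1
    apply Subtype.ext
    simp [show n - 3 + 1 = n - 2 by omega]
  have hbraid := twist_braid (q := q) (j := 0) (hj := by omega) (i := n - 3) (by omega) (by omega)
    (by omega)
  obtain ⟨a, had⟩ : ∃ a, a = twist (j := 0) (by omega) q (centralSigma n 0 (n - 3 + 1)) := ⟨_, rfl⟩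
  obtain ⟨b, hbd⟩ : ∃ b, b = twist (j := 0) (by omega) q (centralSigma n 0 (n - 3)) := ⟨_, rfl⟩
  rw [← had, ← hbd] at hub hbraid
  rw [← had] at ha
  rw [hub] at hu
  have haP : a ∈ P := by
    rw [← inv_mem_iff, ← ha]
    exact hmem 0 (by omega)
  have hbP : b ∉ P := fun hb => hu (mul_inv_mem_commutator_of_braid hbraid.symm haP hb)
  have hPN : P ≤ Subgroup.normalizer (⁅P, P⁆ : Subgroup G) := by
    rw [Subgroup.le_normalizer_iff]
    intro x hx y hy
    have := Subgroup.mul_mem _ (Subgroup.commutator_mem_commutator hx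
      (Subgroup.commutator_le_self P hy)) hy
    rwa [commutatorElement_def, inv_mul_cancel_right] at this
  have huN : b * a⁻¹ ∈ Subgroup.normalizer (⁅P, P⁆ : Subgroup G) := by
    rw [← Subgroup.zpowers_le, Subgroup.le_normalizer_iff]
    rintro _ ⟨k, rfl⟩ y hy
    have hc := commute_of_mem_commutator_closure (j := n - 2) (hj := by omega) (q := q)
      (m := n - 4) (by omega) (by rwa [hP, hsd] at hy)
      (x := ⟨_, sigma_div_mem (i := n - 3) (j := n - 2) (by omega) (by omega)⟩)
      fun i hi => (sigma_commute (by omega)).mul_right (sigma_commute (by omega)).inv_right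
    rw [hub] at hc
    change (b * a⁻¹) ^ k * y * ((b * a⁻¹) ^ k)⁻¹ ∈ _
    rwa [← (hc.zpow_right k).eq, mul_inv_cancel_right]
  have hbN : b ∈ Subgroup.normalizer (⁅P, P⁆ : Subgroup G) := by
    have := Subgroup.mul_mem _ huN (hPN haP)
    rwa [inv_mul_cancel_right] at this
  refine ⟨Subgroup.normalizer (⁅P, P⁆ : Subgroup G), fun htop => ?_, ?_⟩
  -- If [P, P] were normal, `q` modulo [P, P] would kill σ_1σ_0⁻¹, hence all of B'_n, and [P, P]
  -- would contain the excluded element.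
  · have hnormal : (⁅P, P⁆).Normal := Subgroup.normalizer_eq_top_iff.1 htop
    have h1 : q ⟨_, sigma_div_mem (i := 1) (j := 0) (by omega) (by omega)⟩ ∈ ⁅P, P⁆ := by
      have := mul_inv_mem_commutator_of_braid (P := P) (a := s 0) (b := s 1)
        (by rw [hsd]; exact twist_braid (by omega) (by omega) (by omega)) (hmem 0 (by omega))
        (hmem 1 (by omega))
      convert this
      rw [hsd]
      change _ = twist hj q _ * (twist hj q _)⁻¹
      rw [twist_centralSigma (by omega) (by omega), twist_centralSigma (by omega) (by omega),
        ← map_inv, ← map_mul]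
      congr 1
      apply Subtype.ext
      simp
    have h2 := map_eq_one_of_div (f := (QuotientGroup.mk' ⁅P, P⁆).comp q) (by omega)
      ((QuotientGroup.eq_one_iff _).2 h1)
      ⟨_, sigma_div_mem (i := n - 3) (j := n - 2) (by omega) (by omega)⟩
    exact hu (hub ▸ (QuotientGroup.eq_one_iff _).1 h2)
  · have := three_mul_card_le_of_braid hPN hbraid.symm haP hbN hbP
    omega

end Normalizer

end BraidGroup

/-! ### Groups generated by two elements satisfying the braid relation -/

section TwoGenerators

variable {G : Type*} [Group G]

theorem braid_wrap_commute {c d x : G} (h : c * d * c = d * c * d) (hx : Commute d x) :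
    Commute (d * c * x * c * d) c := by
  calc d * c * x * c * d * c = d * c * x * (c * d * c) := by simp only [mul_assoc]
    _ = d * c * (x * d) * c * d := by rw [h]; simp only [mul_assoc]
    _ = (d * c * d) * x * c * d := by rw [← hx.eq]; simp only [mul_assoc]
    _ = c * (d * c * x * c * d) := by rw [← h]; simp only [mul_assoc]

theorem index_centralizer_le {x : G} {T : Finset G} (h : ∀ g, g * x * g⁻¹ ∈ T) :
    (Subgroup.centralizer {x}).index ≤ T.card := by
  rw [← Nat.card_eq_fintype_card.trans (Fintype.card_coe T), Subgroup.index]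
  refine Nat.card_le_card_of_injective
    (fun c : G ⧸ Subgroup.centralizer {x} => (⟨c.out * x * c.out⁻¹, h _⟩ : T)) fun c d hcd => ?_
  have hcd' : c.out * x * c.out⁻¹ = d.out * x * d.out⁻¹ := congrArg Subtype.val hcd
  have key : c.out * (x * (c.out⁻¹ * d.out)) = d.out * x := by
    rw [← mul_assoc, ← mul_assoc, hcd', inv_mul_cancel_right]
  rw [← QuotientGroup.out_eq' c, ← QuotientGroup.out_eq' d, QuotientGroup.eq,
    Subgroup.mem_centralizer_singleton_iff, mul_assoc, inv_mul_eq_iff_eq_mul, key]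

theorem mem_center_of_commute {a b z : G} (hgen : Subgroup.closure {a, b} = ⊤) (ha : Commute z a)
    (hb : Commute z b) : z ∈ Subgroup.center G := by
  rw [← Subgroup.centralizer_univ, ← Subgroup.coe_top, ← hgen, Subgroup.centralizer_closure,
    Subgroup.mem_centralizer_iff]
  rintro y (rfl | rfl)
  · exact ha.symm.eq
  · exact hb.symm.eq

/-- The intersection of ⟨a⟩ and ⟨b⟩ is central, hence trivial, and `b` is conjugate to `a`; so the
product set ⟨a⟩⟨b⟩ has `orderOf a` squared elements. -/
theorem card_ge_of_braid_of_orderOf [Finite G] {a b : G} (h : a * b * a = b * a * b)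
    (hgen : Subgroup.closure {a, b} = ⊤) (hz : Subgroup.center G = ⊥) :
    orderOf a * orderOf a ≤ Nat.card G := by
  have hord : orderOf b = orderOf a := by
    rw [← braid_conj h]
    exact MulEquiv.orderOf_eq (MulAut.conj (a * b)) a
  have hfin : Fintype (Subgroup.zpowers a) := Fintype.ofFinite _
  have := card_mul_card_le_of_transversal (L := Subgroup.zpowers b) (M := ⊤) le_top
    (fun x : Subgroup.zpowers a => (x : G)) (fun _ => trivial) fun x y hxy hmem => hxy <| by
      have hc : ((x : G))⁻¹ * y ∈ Subgroup.center G := mem_center_of_commute hgen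
        (commute_of_mem_zpowers (Subgroup.mul_mem _ (Subgroup.inv_mem _ x.2) y.2))
        (commute_of_mem_zpowers hmem)
      rw [hz, Subgroup.mem_bot, inv_mul_eq_one] at hc
      exact Subtype.ext hc
  rwa [← Nat.card_eq_fintype_card, Nat.card_zpowers, Nat.card_zpowers, hord,
    Subgroup.card_top] at this

/-- The set {a², b², a²b²} is stable under conjugation by `a` and `b`, so it contains every
conjugate of a². -/
theorem index_centralizer_sq_le {a b : G} (h : a * b * a = b * a * b)
    (hgen : Subgroup.closure {a, b} = ⊤) (hD : (a * b * a) * (a * b * a) = 1) (ha : a ^ 4 = 1) :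
    (Subgroup.centralizer {a ^ 2}).index ≤ 3 := by
  classical
  have hb : b ^ 4 = 1 := by rw [← braid_conj_pow h, ha, mul_one, mul_inv_cancel]
  have h1 : a * b ^ 2 * a = b ^ 2 := braid_mul_sq_mul h hD ha
  have h2 : b * a ^ 2 * b = a ^ 2 := braid_mul_sq_mul h.symm (by rwa [← h]) hb
  have ha2 : a⁻¹ = a ^ 2 * a := by
    rw [inv_eq_iff_mul_eq_one, ← pow_succ, ← pow_succ', ha]
  have hb2 : b⁻¹ = b ^ 2 * b := by
    rw [inv_eq_iff_mul_eq_one, ← pow_succ, ← pow_succ', hb]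
  have haa : a ^ 2 * a ^ 2 = 1 := by rw [← pow_add, ha]
  have hbb : b ^ 2 * b ^ 2 = 1 := by rw [← pow_add, hb]
  have hc : Commute (a ^ 2) (b ^ 2) := by
    have : a ^ 2 * b ^ 2 * a ^ 2 = b ^ 2 := by
      calc a ^ 2 * b ^ 2 * a ^ 2 = a * (a * b ^ 2 * a) * a := by simp only [pow_two, mul_assoc]
        _ = b ^ 2 := by rw [h1, h1]
    calc a ^ 2 * b ^ 2 = a ^ 2 * b ^ 2 * (a ^ 2 * a ^ 2) := by rw [haa, mul_one]
      _ = (a ^ 2 * b ^ 2 * a ^ 2) * a ^ 2 := by simp only [mul_assoc]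
      _ = b ^ 2 * a ^ 2 := by rw [this]
  have hab : a * b ^ 2 * a⁻¹ = a ^ 2 * b ^ 2 := by
    calc a * b ^ 2 * a⁻¹ = a * b ^ 2 * (a * a ^ 2) := by rw [ha2, ← pow_succ, ← pow_succ']
      _ = (a * b ^ 2 * a) * a ^ 2 := by simp only [mul_assoc]
      _ = a ^ 2 * b ^ 2 := by rw [h1, hc.eq]
  have hba : b * a ^ 2 * b⁻¹ = a ^ 2 * b ^ 2 := by
    calc b * a ^ 2 * b⁻¹ = b * a ^ 2 * (b * b ^ 2) := by rw [hb2, ← pow_succ, ← pow_succ']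
      _ = (b * a ^ 2 * b) * b ^ 2 := by simp only [mul_assoc]
      _ = a ^ 2 * b ^ 2 := by rw [h2]
  have hself : ∀ x : G, x * x ^ 2 * x⁻¹ = x ^ 2 := fun x => by
    rw [← pow_succ', pow_succ, mul_inv_cancel_right]
  have hT : ∀ g, ∀ t ∈ ({a ^ 2, b ^ 2, a ^ 2 * b ^ 2} : Finset G),
      g * t * g⁻¹ ∈ ({a ^ 2, b ^ 2, a ^ 2 * b ^ 2} : Finset G) := by
    have hconj : ∀ g x y : G, g * (x * y) * g⁻¹ = g * x * g⁻¹ * (g * y * g⁻¹) := fun g x y => by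
      group
    intro g
    have hg : g ∈ Subgroup.closure {a, b} := hgen ▸ Subgroup.mem_top g
    have hpow : ∀ x ∈ ({a, b} : Set G), ∀ t ∈ ({a ^ 2, b ^ 2, a ^ 2 * b ^ 2} : Finset G),
        x * t * x⁻¹ ∈ ({a ^ 2, b ^ 2, a ^ 2 * b ^ 2} : Finset G) := by
      intro x hx t ht
      simp only [Finset.mem_insert, Finset.mem_singleton] at ht ⊢
      obtain rfl | rfl := hx <;> obtain rfl | rfl | rfl := ht
      · exact Or.inl (hself x)
      · exact Or.inr (Or.inr hab)
      · rw [hconj, hself, hab, ← mul_assoc, haa, one_mul]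
        exact Or.inr (Or.inl rfl)
      · exact Or.inr (Or.inr hba)
      · exact Or.inr (Or.inl (hself x))
      · rw [hconj, hself, hba, mul_assoc, hbb, mul_one]
        exact Or.inl rfl
    induction hg using Subgroup.closure_induction_left with
    | one => simp
    | mul_left x hx y _ ih =>
      intro t ht
      have := hpow x hx _ (ih t ht)
      rwa [show x * y * t * (x * y)⁻¹ = x * (y * t * y⁻¹) * x⁻¹ by group]
    | inv_mul_cancel x hx y _ ih =>
      intro t ht
      have hx4 : x⁻¹ = x * x * x := by
        obtain rfl | rfl := hx
        · rw [ha2, pow_two]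
        · rw [hb2, pow_two]
      have := hpow x hx _ (hpow x hx _ (hpow x hx _ (ih t ht)))
      rw [hx4]
      rwa [show x * x * x * y * t * (x * x * x * y)⁻¹ =
        x * (x * (x * (y * t * y⁻¹) * x⁻¹) * x⁻¹) * x⁻¹ by group]
  exact (index_centralizer_le fun g => hT g (a ^ 2) (by simp)).trans Finset.card_le_three

end TwoGenerators

namespace BraidGroup

variable {n : ℕ}

/-! ### Small quotients and subgroups of small index -/

section Index

theorem squaresAgree_of_map_eq_one {G : Type*} [Group G] {q : commutator (BraidGroup n) →* G}
    (hn : 5 ≤ n) {x : commutator (BraidGroup n)}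
    (hx : (x : BraidGroup n) = sigma n 0 ^ 2 * (sigma n 1 ^ 2)⁻¹) (h : q x = 1) :
    SquaresAgree q := by
  refine squaresAgree_of_commute (i := 0) (by omega) ?_
  have hc : Commute (x : BraidGroup n) (sigma n 3) := by
    rw [hx]
    exact ((sigma_commute (by omega)).pow_left 2).mul_left
      ((sigma_commute (by omega)).pow_left 2).inv_left
  have h2 := mem_core_of_commute h (j := 3) (by omega) hc
  have h3 : gen q 0 ^ 2 = gen q 1 ^ 2 := by
    rw [gen, gen, ← mul_inv_eq_one, ← map_pow, ← map_pow, ← map_inv, ← map_mul, ← hx]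
    exact (QuotientGroup.eq_one_iff _).2 h2
  rw [h3]
  exact Commute.pow_self _ 2

/-- The homomorphism of braid groups given by adding strands. -/
def inclusion {m n : ℕ} (h : m ≤ n) : BraidGroup m →* BraidGroup n :=
  lift (sigma n) (fun _ hi => sigma_braid (by omega)) fun _ _ hij _ => sigma_commute hij

theorem inclusion_sigma {m n i : ℕ} (h : m ≤ n) (hi : i < m - 1) :
    inclusion h (sigma m i) = sigma n i :=
  lift_sigma _ _ hi

theorem inclusion_mem {m n : ℕ} (h : m ≤ n) (x : commutator (BraidGroup m)) :
    inclusion h x ∈ commutator (BraidGroup n) := by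
  have hle : (commutator (BraidGroup m)).map (inclusion h) ≤ commutator (BraidGroup n) := by
    rw [commutator_def, Subgroup.map_commutator]
    exact Subgroup.commutator_mono le_top le_top
  exact hle (Subgroup.mem_map_of_mem _ x.2)

/-- The map of commutator subgroups given by adding strands. -/
def stabilize {m n : ℕ} (h : m ≤ n) : commutator (BraidGroup m) →* commutator (BraidGroup n) :=
  ((inclusion h).comp (commutator (BraidGroup m)).subtype).codRestrict _ (inclusion_mem h)

/-- If squares do not agree and n ≥ 6, `q` is restricted to B'_{n-1}. The braid σ_0²σ_1⁻² still
survives, so the image is nontrivial without agreeing squares and `ih` applies. For n = 5 the bound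
21 > 12 suffices. -/
theorem lt_card_of_surjective {G : Type u} [Group G] [Finite G] [Nontrivial G]
    {q : commutator (BraidGroup n) →* G} (hn : 5 ≤ n) (hq : Function.Surjective q)
    (ih : 6 ≤ n → ∀ {H : Type u} [Group H] [Finite H] [Nontrivial H]
      {p : commutator (BraidGroup (n - 1)) →* H}, Function.Surjective p → ¬ SquaresAgree p →
        (n - 1)! / 2 < Nat.card H) :
    (n - 1)! / 2 < Nat.card G := by
  have hfac : n ! = n * (n - 1)! := (Nat.mul_factorial_pred (by omega)).symm
  by_cases hs : SquaresAgree q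
  · rw [nat_card_of_squaresAgree hn hq hs, hfac]
    have h2 : 2 ≤ (n - 1)! := (Nat.factorial_le (show 2 ≤ n - 1 by omega))
    have : 5 * (n - 1)! ≤ n * (n - 1)! := Nat.mul_le_mul_right _ hn
    omega
  obtain rfl | hn6 := hn.eq_or_lt
  · have := card_ge_of_not_squaresAgree (j := 3) (hj := by omega) hn hs (i := 0) (by omega)
      (by omega) (by omega) (P := ⊤) trivial trivial
    rw [Subgroup.card_top] at this
    exact lt_of_lt_of_le (by decide) this
  · obtain ⟨r, hr⟩ : ∃ r, r = q.comp (stabilize (m := n - 1) (n := n) (by omega)) := ⟨_, rfl⟩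
    have h01 : sigma (n - 1) 0 ^ 2 * (sigma (n - 1) 1 ^ 2)⁻¹ ∈ commutator (BraidGroup (n - 1)) := by
      rw [mem_commutator_iff, map_mul, map_inv, map_pow, map_pow, deg_sigma (by omega),
        deg_sigma (by omega), mul_inv_cancel]
    have hr1 : r ⟨_, h01⟩ ≠ 1 := by
      intro h
      refine hs (squaresAgree_of_map_eq_one hn ?_ (by rwa [hr] at h))
      change inclusion (Nat.sub_le n 1) (_ * _) = _
      rw [map_mul, map_inv, map_pow, map_pow, inclusion_sigma _ (by omega),
        inclusion_sigma _ (by omega)]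
    have hnt : Nontrivial r.range := ⟨⟨r.rangeRestrict ⟨_, h01⟩, 1, fun h =>
      hr1 (congrArg Subtype.val h)⟩⟩
    refine (ih hn6 (p := r.rangeRestrict) r.rangeRestrict_surjective fun h => hr1 ?_).trans_le
      (Subgroup.card_le_card_group _)
    have h2 := h 0 1 (by omega) (by omega)
    rw [gen, gen, ← mul_inv_eq_one, ← map_pow, ← map_pow, ← map_inv, ← map_mul] at h2
    exact congrArg Subtype.val (eq_one_of_mem_core (x := ⟨_, h01⟩) ((QuotientGroup.eq_one_iff _).1 h2))

/-- The action on cosets of `X` is nontrivial and, as B'_n is perfect, even. With fewer than n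
cosets its image would have at most (n-1)!/2 elements, against `hsmall`. -/
theorem le_index_of_ne_top {G : Type u} [Group G] [Finite G]
    {q : commutator (BraidGroup n) →* G} (hn : 5 ≤ n) (hq : Function.Surjective q)
    (hsmall : ∀ {H : Type u} [Group H] [Finite H] [Nontrivial H]
      {p : commutator (BraidGroup n) →* H}, Function.Surjective p → (n - 1)! / 2 < Nat.card H)
    {X : Subgroup G} (hX : X ≠ ⊤) : n ≤ X.index := by
  classical
  by_contra! hlt
  have hfin : Fintype (G ⧸ X) := Fintype.ofFinite _
  obtain ⟨f, hf⟩ : ∃ f, f = (MulAction.toPermHom G (G ⧸ X)).comp q := ⟨_, rfl⟩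
  have hle : f.range ≤ alternatingGroup (G ⧸ X) := by
    rintro _ ⟨x, rfl⟩
    exact map_eq_one_of_comm hn ((Equiv.Perm.sign (α := G ⧸ X)).comp f) x
  obtain ⟨g, hg⟩ : ∃ g, g ∉ X := by
    by_contra! h
    exact hX (eq_top_iff.2 fun g _ => h g)
  obtain ⟨x, rfl⟩ := hq g
  have hfx : f x ≠ 1 := by
    intro h
    have h1 : q x • ((1 : G) : G ⧸ X) = ((1 : G) : G ⧸ X) := by
      rw [hf] at h
      exact Equiv.ext_iff.1 h ((1 : G) : G ⧸ X)
    have h2 : ((1 : G) : G ⧸ X) = ((q x * 1 : G) : G ⧸ X) := h1.symm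
    rw [QuotientGroup.eq] at h2
    simp only [inv_one, one_mul, mul_one] at h2
    exact hg h2
  have hnt : Nontrivial f.range := ⟨⟨f.rangeRestrict x, 1, fun h => hfx (congrArg Subtype.val h)⟩⟩
  have h1 := hsmall f.rangeRestrict_surjective
  have h2 := Subgroup.card_le_of_le hle
  have hnt2 : Nontrivial (G ⧸ X) := QuotientGroup.nontrivial_iff.2 hX
  rw [nat_card_alternatingGroup] at h2
  have h3 : (Nat.card (G ⧸ X))! ≤ (n - 1)! := Nat.factorial_le (by
    rw [Subgroup.index] at hlt; omega)
  omega

end Index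

end BraidGroup

namespace BraidGroup

variable {n : ℕ}

/-! ### Five strands -/

section FiveStrands

variable {G : Type u} [Group G] {q : commutator (BraidGroup 5) →* G}

theorem commutator_eq_top (hn : 5 ≤ n) {q : commutator (BraidGroup n) →* G}
    (hq : Function.Surjective q) : commutator G = ⊤ := by
  rw [eq_top_iff]
  intro g _
  obtain ⟨x, rfl⟩ := hq g
  rw [← Abelianization.ker_of, MonoidHom.mem_ker]
  exact map_eq_one_of_comm hn (Abelianization.of.comp q) x

/-- As G is perfect, it is the commutator subgroup of the group generated by the two twisted
elements. Thus q(x) commutes with all of G, and the center is trivial. -/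
theorem mem_core_of_commute_zero_one (hq : Function.Surjective q)
    (hgen : Subgroup.closure {twist (j := 3) (by omega) q (centralSigma 5 3 0),
      twist (j := 3) (by omega) q (centralSigma 5 3 1)} = ⊤)
    (hz : Subgroup.center G = ⊥) {x : BraidGroup 5} (hx : x ∈ commutator (BraidGroup 5))
    (h0 : Commute x (sigma 5 0)) (h1 : Commute x (sigma 5 1)) : x ∈ core q := by
  have hset : (fun i => twist (j := 3) (by omega) q (centralSigma 5 3 i)) '' Set.Iio 2 =
      {twist (j := 3) (by omega) q (centralSigma 5 3 0),
        twist (j := 3) (by omega) q (centralSigma 5 3 1)} := by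
    rw [show (Set.Iio 2 : Set ℕ) = {0, 1} by ext i; simp; omega, Set.image_pair]
  have hc : q ⟨x, hx⟩ ∈ Subgroup.center G := by
    rw [Subgroup.mem_center_iff]
    intro g
    refine (commute_of_mem_commutator_closure (j := 3) (m := 2) (hj := by omega) (q := q) le_rfl ?_
      (x := ⟨x, hx⟩) fun i hi => ?_).eq
    · rw [hset, hgen, ← commutator_def, commutator_eq_top le_rfl hq]
      trivial
    · obtain rfl | rfl : i = 0 ∨ i = 1 := by omega
      · exact h0.symm
      · exact h1.symm
  rw [hz, Subgroup.mem_bot] at hc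
  exact mem_core_of_commute hc (j := 0) (by omega) h0

theorem gen_pow_eight_eq (hq : Function.Surjective q)
    (hgen : Subgroup.closure {twist (j := 3) (by omega) q (centralSigma 5 3 0),
      twist (j := 3) (by omega) q (centralSigma 5 3 1)} = ⊤)
    (hz : Subgroup.center G = ⊥) : gen q 0 ^ 8 = gen q 1 ^ 8 := by
  have h01 := sigma_braid (n := 5) (i := 0) (by omega)
  have h12 := sigma_braid (n := 5) (i := 1) (by omega)
  have h02 := sigma_commute (n := 5) (i := 0) (j := 2) (by omega)
  have h03 := sigma_commute (n := 5) (i := 0) (j := 3) (by omega)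
  have h13 := sigma_commute (n := 5) (i := 1) (j := 3) (by omega)
  have h23 := sigma_braid (n := 5) (i := 2) (by omega)
  simp only [zero_add, Nat.reduceAdd] at h01 h12 h23
  -- `A` = σ_2σ_1σ_0²σ_1σ_2 is one strand encircling the three before it. It has degree 6 and
  -- commutes with σ_0 and σ_1, so it equals σ_3⁶ modulo the core. Since σ_3Aσ_3 commutes with σ_2,
  -- so does σ_3⁸ modulo the core.
  obtain ⟨Y, hY⟩ : ∃ Y, Y = sigma 5 1 * sigma 5 0 * 1 * sigma 5 0 * sigma 5 1 := ⟨_, rfl⟩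
  obtain ⟨A, hA⟩ : ∃ A, A = sigma 5 2 * Y * sigma 5 2 := ⟨_, rfl⟩
  have hY0 : Commute Y (sigma 5 0) := hY ▸ braid_wrap_commute h01 (Commute.one_right _)
  have hY3 : Commute Y (sigma 5 3) := by
    rw [hY]
    exact (((h13.mul_left h03).mul_left (Commute.one_left _)).mul_left h03).mul_left h13
  have hA0 : Commute A (sigma 5 0) := by
    rw [hA]
    exact (h02.symm.mul_left hY0).mul_left h02.symm
  have hA1 : Commute A (sigma 5 1) := by
    have := braid_wrap_commute (x := sigma 5 0 * sigma 5 0) h12 (h02.symm.mul_right h02.symm)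
    rw [hA, hY]
    simpa [mul_assoc] using this
  have hA2 : Commute (sigma 5 3 * A * sigma 5 3) (sigma 5 2) := by
    have := braid_wrap_commute h23 hY3.symm
    rw [hA]
    simpa [mul_assoc] using this
  have hmem : A * (sigma 5 3 ^ 6)⁻¹ ∈ commutator (BraidGroup 5) := by
    rw [mem_commutator_iff, hA, hY]
    simp only [map_mul, map_inv, map_pow, map_one, deg_sigma (n := 5) (show 0 < 5 - 1 by omega),
      deg_sigma (n := 5) (show 1 < 5 - 1 by omega), deg_sigma (n := 5) (show 2 < 5 - 1 by omega),
      deg_sigma (n := 5) (show 3 < 5 - 1 by omega)]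
    rfl
  have hcore := mem_core_of_commute_zero_one hq hgen hz hmem
    (hA0.mul_left (h03.symm.pow_left 6).inv_left) (hA1.mul_left (h13.symm.pow_left 6).inv_left)
  have h6 : QuotientGroup.mk' (core q) A = gen q 3 ^ 6 := by
    rw [gen, ← map_pow, ← mul_inv_eq_one, ← map_inv, ← map_mul]
    exact (QuotientGroup.eq_one_iff _).2 hcore
  have h8 := hA2.map (QuotientGroup.mk' (core q))
  rw [map_mul, map_mul, h6] at h8
  change Commute (gen q 3 * gen q 3 ^ 6 * gen q 3) (gen q 2) at h8
  rw [← pow_succ', ← pow_succ] at h8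
  exact gen_pow_eq (i₀ := 2) (by omega) (braid_commute_pow_symm (gen_braid (by omega)) h8) 0 1
    (by omega) (by omega)

theorem pow_eight_eq_one (hq : Function.Surjective q) {a b : G}
    (ha : a = twist (j := 3) (by omega) q (centralSigma 5 3 0))
    (hb : b = twist (j := 3) (by omega) q (centralSigma 5 3 1))
    (hgen : Subgroup.closure {a, b} = ⊤)
    (hz : Subgroup.center G = ⊥) : a ^ 8 = 1 := by
  have hab : a ^ 8 = b ^ 8 := by
    have h8 := gen_pow_eight_eq hq (ha ▸ hb ▸ hgen) hz
    have hmem : ((centralSigma 5 3 0 ^ 8 * (centralSigma 5 3 1 ^ 8)⁻¹ :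
        Subgroup.centralizer {sigma 5 3}) : BraidGroup 5) ∈ core q := by
      refine (QuotientGroup.eq_one_iff _).1 ?_
      change QuotientGroup.mk' (core q) _ = 1
      simp only [Subgroup.coe_mul, Subgroup.coe_inv, Subgroup.coe_pow,
        coe_centralSigma (n := 5) (j := 3) (i := 0) (by omega),
        coe_centralSigma (n := 5) (j := 3) (i := 1) (by omega)]
      rw [map_mul, map_inv, map_pow, map_pow]
      exact mul_inv_eq_one.2 h8
    have hmem' : ((centralSigma 5 3 0 ^ 8 * (centralSigma 5 3 1 ^ 8)⁻¹ :
        Subgroup.centralizer {sigma 5 3}) : BraidGroup 5) ∈ commutator (BraidGroup 5) := by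
      obtain ⟨y, -, hy⟩ := Subgroup.normalCore_le _ hmem
      rw [← hy]
      exact y.2
    have h1 := twist_of_mem (q := q) (j := 3) (hj := by omega) hmem'
    rw [eq_one_of_mem_core (x := ⟨_, hmem'⟩) hmem, map_mul, map_inv, map_pow, map_pow, ← ha, ← hb,
      mul_inv_eq_one] at h1
    exact h1
  have hc : a ^ 8 ∈ Subgroup.center G :=
    mem_center_of_commute hgen (Commute.pow_self a 8) (hab ▸ Commute.pow_self b 8)
  rwa [hz, Subgroup.mem_bot] at hc

theorem lt_card_of_center_eq_bot [Finite G] [Nontrivial G] (hq : Function.Surjective q)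
    (hs : ¬ SquaresAgree q) {a b : G}
    (ha : a = twist (j := 3) (by omega) q (centralSigma 5 3 0))
    (hb : b = twist (j := 3) (by omega) q (centralSigma 5 3 1))
    (hgen : Subgroup.closure {a, b} = ⊤) (hz : Subgroup.center G = ⊥) : 60 < Nat.card G := by
  have h8 := pow_eight_eq_one hq ha hb hgen hz
  have hbr : a * b * a = b * a * b := by
    rw [ha, hb]
    exact twist_braid (i := 0) (by omega) (by omega) (by omega)
  have h2 : ¬ Commute (a ^ 2) b := by
    rw [ha, hb]
    exact not_commute_twist_sq hs (i := 0) (by omega) (by omega) (by omega)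
  have hD : (a * b * a) * (a * b * a) = 1 := by
    have := mem_center_of_commute hgen (braid_full_twist_commute_left hbr)
      (braid_full_twist_commute_right hbr)
    rwa [hz, Subgroup.mem_bot] at this
  by_cases h4 : a ^ 4 = 1
  · exfalso
    refine h2 ?_
    -- An index of at most 3 is impossible for a proper subgroup, whose index is at least 5.
    have hX : Subgroup.centralizer {a ^ 2} = ⊤ := by
      by_contra hX
      have h3 := index_centralizer_sq_le hbr hgen hD h4
      have h5 := le_index_of_ne_top le_rfl hq
        (fun hp => lt_card_of_surjective le_rfl hp (fun h => absurd h (by omega))) hX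
      omega
    have hbm : b ∈ Subgroup.centralizer {a ^ 2} := hX ▸ Subgroup.mem_top b
    exact (Subgroup.mem_centralizer_singleton_iff.1 hbm).symm
  -- The order is exactly 8, and 8 · 8 = 64 > 60.
  · have hord : orderOf a = 2 ^ (2 + 1) := orderOf_eq_prime_pow h4 h8
    have := card_ge_of_braid_of_orderOf hbr hgen hz
    rw [hord] at this
    omega

/-- Induction on a bound for the order allows a nontrivial center to be divided out. The quotient
has at least 60 elements, and the center at least doubles that. -/
theorem lt_card_of_five_strands : ∀ (N : ℕ) {G : Type u} [Group G] [Finite G] [Nontrivial G]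
    {q : commutator (BraidGroup 5) →* G}, Nat.card G ≤ N → Function.Surjective q →
    ¬ SquaresAgree q → 60 < Nat.card G := by
  intro N
  induction N with
  | zero =>
    intro G _ _ _ q hN
    have := Nat.card_pos (α := G)
    omega
  | succ N ih =>
    intro G _ _ _ q hN hq hs
    obtain ⟨a, ha⟩ : ∃ a, a = twist (j := 3) (by omega) q (centralSigma 5 3 0) := ⟨_, rfl⟩
    obtain ⟨b, hb⟩ : ∃ b, b = twist (j := 3) (by omega) q (centralSigma 5 3 1) := ⟨_, rfl⟩
    by_cases hgen : Subgroup.closure {a, b} = ⊤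
    · by_cases hz : Subgroup.center G = ⊥
      · exact lt_card_of_center_eq_bot hq hs ha hb hgen hz
      · have hcard := Subgroup.card_eq_card_quotient_mul_card_subgroup (Subgroup.center G)
        have hz2 : 1 < Nat.card (Subgroup.center G) :=
          (Subgroup.one_lt_card_iff_ne_bot _).2 hz
        have hpos := Nat.card_pos (α := G ⧸ Subgroup.center G)
        have hnt : Nontrivial (G ⧸ Subgroup.center G) := by
          refine QuotientGroup.nontrivial_iff.2 fun htop => ?_
          have h1 : commutator G = ⊥ := by
            rw [commutator_def, Subgroup.commutator_eq_bot_iff_le_centralizer, Subgroup.coe_top,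
              Subgroup.centralizer_univ, htop]
          rw [commutator_eq_top le_rfl hq] at h1
          exact top_ne_bot h1
        obtain ⟨p, hp⟩ : ∃ p, p = (QuotientGroup.mk' (Subgroup.center G)).comp q := ⟨_, rfl⟩
        have hps : Function.Surjective p := by
          rw [hp]
          exact (QuotientGroup.mk'_surjective _).comp hq
        by_cases hsp : SquaresAgree p
        · have h60 := nat_card_of_squaresAgree le_rfl hps hsp
          rw [hcard, h60, show 5 ! / 2 = 60 from rfl]
          omega
        · have := ih (q := p) (by nlinarith) hps hsp
          nlinarith
    · have haP : twist (j := 3) (by omega) q (centralSigma 5 3 0) ∈ Subgroup.closure {a, b} := by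
        rw [← ha]
        exact Subgroup.subset_closure (by simp)
      have hbP : twist (j := 3) (by omega) q (centralSigma 5 3 1) ∈ Subgroup.closure {a, b} := by
        rw [← hb]
        exact Subgroup.subset_closure (by simp)
      -- Order at least 21 and index at least 5 give at least 105 elements.
      have hP := card_ge_of_not_squaresAgree (j := 3) (hj := by omega) le_rfl hs (i := 0) (by omega)
        (by omega) (by omega) haP hbP
      have h5 := le_index_of_ne_top le_rfl hq
        (fun hp => lt_card_of_surjective le_rfl hp (fun h => absurd h (by omega))) hgen
      have := Subgroup.card_mul_index (Subgroup.closure {a, b})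
      nlinarith

end FiveStrands

/-! ### The main theorem -/

theorem lt_card_of_not_squaresAgree (hn : 5 ≤ n) : ∀ {G : Type u} [Group G] [Finite G]
    [Nontrivial G] {q : commutator (BraidGroup n) →* G}, Function.Surjective q →
    ¬ SquaresAgree q → n ! / 2 < Nat.card G := by
  induction n, hn using Nat.le_induction with
  | base =>
    intro G _ _ _ q hq hs
    exact lt_card_of_five_strands _ le_rfl hq hs
  | succ n hn ih =>
    intro G _ _ _ q hq hs
    obtain ⟨X, hX, hcard⟩ := exists_proper_subgroup (by omega) hs
    have h1 := le_index_of_ne_top (by omega) hq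
      (fun hp => lt_card_of_surjective (by omega) hp (fun _ _ _ _ _ _ => ih)) hX
    have h2 := Subgroup.card_mul_index X
    rw [Nat.add_sub_cancel] at hcard
    rw [Nat.factorial_succ]
    have h3 : (n + 1) * n ! < (n + 1) * (2 * Nat.card X) :=
      Nat.mul_lt_mul_of_pos_left hcard (by omega)
    have h4 := Nat.mul_le_mul_left (Nat.card X) h1
    rw [h2] at h4
    have h5 : (n + 1) * (2 * Nat.card X) = 2 * (Nat.card X * (n + 1)) := by ring
    omega

end BraidGroup

theorem theorem1 (n : ℕ) (hn : 5 ≤ n) {G : Type*} [Group G] [Nontrivial G]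
    (q : commutator (BraidGroup n) →* G) (hq : Function.Surjective q) :
    (((n ! / 2 : ℕ) : ℕ∞) < ENat.card G ∨ Nonempty (G ≃* alternatingGroup (Fin n))) ∧
      ∀ e : G ≃* alternatingGroup (Fin n), ∃ α : MulAut (alternatingGroup (Fin n)),
        ∀ x : commutator (BraidGroup n), e (q x) = α (BraidGroup.toAlternating n x) := by
  by_cases hs : BraidGroup.SquaresAgree q
  · obtain ⟨f, hf⟩ := BraidGroup.exists_mulEquiv_of_squaresAgree hn hq hs
    exact ⟨Or.inr ⟨f.symm⟩, fun e => ⟨f.trans e, fun x => by rw [← hf]; rfl⟩⟩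
  · refine ⟨Or.inl ?_, fun e => ?_⟩
    · cases finite_or_infinite G
      · rw [ENat.card_eq_coe_natCard]
        exact_mod_cast BraidGroup.lt_card_of_not_squaresAgree hn hq hs
      · rw [ENat.card_eq_top_of_infinite]
        exact ENat.natCast_lt_top _
    · have hfin : Finite G := Finite.of_equiv _ e.symm.toEquiv
      have h1 := BraidGroup.lt_card_of_not_squaresAgree hn hq hs
      have hnt : Nontrivial (Fin n) := Fin.nontrivial_iff_two_le.2 (by omega)
      rw [Nat.card_congr e.toEquiv, nat_card_alternatingGroup, Nat.card_fin] at h1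
      exact absurd h1 (lt_irrefl _)
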